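/- Throughout, $n\ge 1$, Hilbert spaces are complex, and $\mathbb N_\infty=\mathbb N\cup\{\infty\}$ with $\mathbb N=\{0,1,2,\dots\}$; dimensions are taken in $\mathbb N_\infty$. For a word $\alpha=g_{i_1}\cdots g_{i_k}$ in the free semigroup $\mathbb F_n^+$ put $|\alpha|=k$ and $X_\alpha=X_{i_1}\cdots X_{i_k}$, with $X_\alpha=I$ for the empty word. Let $T=(T_1,\dots,T_n)$ be a row contraction on a Hilbert space $\mathcal H$, i.e. $T_i\in B(\mathcal H)$ and $\sum_i T_iT_i^*\le I$; write $T$ also for the row operator $[T_1\cdots T_n]:\mathcal H^{(n)}\to\mathcal H$. $T$ is *pure* if $\lim_{k\to\infty}\sum_{|\gamma|=k}\|T_\gamma^*h\|^2=0$ for all $h\in\mathcal H$, and an *isometry* if the row operator is one. An $n$-tuple $N$ is *nilpotent* if for some $m\in\mathbb N$ one has $N_\alpha=0$ whenever $|\alpha|=m$; the least such $m$ is its order. Let $$\Delta_T=\Big(I-\sum_i T_iT_i^*\Big)^{1/2},\quad \Delta_{T^*}=(I-T^*T)^{1/2},\quad \mathcal D_T=\overline{\Delta_T\mathcal H},\quad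 \mathcal D_{T^*}=\overline{\Delta_{T^*}\mathcal H^{(n)}} .$$ For a Hilbert space $\mathcal G$ let $[B(\mathcal G)^n]_1=\{X\in B(\mathcal G)^n:\|\sum_i X_iX_i^*\|<1\}$. The *characteristic function* of $T$ is $$\Theta_T(X)=-I_{\mathcal G}\otimes T|_{\mathcal D_{T^*}}+(I_{\mathcal G}\otimes\Delta_T)\Big(I-\sum_i X_i\otimes T_i^*\Big)^{-1}[X_1\otimes I_{\mathcal H},\dots,X_n\otimes I_{\mathcal H}]\,(I_{\mathcal G}\otimes\Delta_{T^*}|_{\mathcal D_{T^*}}),\qquad X\in[B(\mathcal G)^n]_1,$$ an operator from $\mathcal G\otimes\mathcal D_{T^*}$ to $\mathcal G\otimes\mathcal D_T$. It is *polynomial of degree at most $m$* if there are $A_{(\alpha)}\in B(\mathcal D_{T^*},\mathcal D_T)$ with $\Theta_T(X)=\sum_{|\alpha|\le m}X_\alpha\otimes A_{(\alpha)}$ for all Hilbert spaces $\mathcal G$ and all $X\in[B(\mathcal G)^n]_1$; $\deg\Theta_T\in\mathbb N_\infty$ is the least such $m$ (so it is $0$ for constants, including $0$), and $\infty$ if there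 is none. For row contractions $T$ on $\mathcal H$ and $T'$ on $\mathcal H'$, $\Theta_T$ and $\Theta_{T'}$ *coincide* if there are unitaries $\tau_1:\mathcal D_{T^*}\to\mathcal D_{T'^*}$ and $\tau_2:\mathcal D_T\to\mathcal D_{T'}$ with $\Theta_{T'}(X)(I_{\mathcal G}\otimes\tau_1)=(I_{\mathcal G}\otimes\tau_2)\Theta_T(X)$ for all $X\in[B(\mathcal G)^n]_1$, where $\mathcal G$ is a fixed (arbitrary) infinite-dimensional Hilbert space. $T$ and $T'$ are *unitarily equivalent* if $UT_i=T_i'U$ for all $i$, for some unitary $U:\mathcal H\to\mathcal H'$. Let $K_T:\mathcal H\to F^2(H_n)\otimes\mathcal D_T$, $K_Th=\sum_{\alpha\in\mathbb F_n^+}e_\alpha\otimes\Delta_TT_\alpha^*h$, be the noncommutative Poisson kernel, where $F^2(H_n)$ is the full Fock space with orthonormal basis $(e_\alpha)_{\alpha\in\mathbb F_n^+}$. Let $\mathcal D_m=\overline{\mathrm{span}}\{T_\beta\Delta_Th:h\in\mathcal H,\ |\beta|\ge m\}$. Define $\Gamma(T)=(p,m,q)\in\mathbb N_\infty^3$ by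 $m=\deg\Theta_T$, $q=\dim\ker K_T$, and $p=\dim(\mathcal D_m\ominus\mathcal D_{m+1})$ if $m\in\mathbb N$, $p=\dim\mathcal D_T$ if $m=\infty$. **Theorem.** Let $T$ be a row contraction on $\mathcal H$. (i) $T$ is a pure row contraction with polynomial characteristic function if and only if $\Gamma(T)\in\mathbb N_\infty\times\mathbb N\times\{0\}$. In this case, with $m=\deg\Theta_T$, $\mathcal H_v=\mathcal D_m$ and $\mathcal H_{nil}=\mathcal D_0\ominus\mathcal D_m$, one has $\mathcal H=\mathcal H_v\oplus\mathcal H_{nil}$ and, with respect to this decomposition, $$T_i=\begin{bmatrix}V_i&*\\0&N_i\end{bmatrix},\qquad i=1,\dots,n,$$ where $V=(V_1,\dots,V_n)$ is a pure isometry (a pure row contraction that is an isometry) and $N=(N_1,\dots,N_n)$ is a nilpotent row contraction of order at most $m$. (ii) The pair $(\Gamma(T),\Theta_T)$ detects the pure row contractions with polynomial characteristic function and completely classifies them up to unitary equivalence. That is, for row contractions $T$ on $\mathcal H$ and $T'$ on $\mathcal H'$: $T$ and $T'$ are unitarily equivalent pure row contractions with polynomial characteristic functions if and only if $\Gamma(T),\Gamma(T')\in\mathbb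 N_\infty\times\mathbb N\times\{0\}$ and $\Theta_T$, $\Theta_{T'}$ coincide. Moreover, if $T$ and $T'$ are pure with polynomial characteristic functions, they are unitarily equivalent if and only if $\Gamma(T)=\Gamma(T')$ and $\Theta_T$, $\Theta_{T'}$ coincide. -/

import Mathlib

open scoped TensorProduct InnerProductSpace InnerProduct
open Filter Topology

noncomputable section

namespace RowContr

universe u v w

/-! ### Words in the free semigroup `𝔽ₙ⁺` -/

/-- The finite set of the words `α ∈ 𝔽ₙ⁺` with `|α| = k`. -/
def words (n k : ℕ) : Finset (FreeMonoid (Fin n)) :=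
  ((List.finite_length_eq (Fin n) k).image FreeMonoid.ofList).toFinset

theorem mem_words {n k : ℕ} {α : FreeMonoid (Fin n)} : α ∈ words n k ↔ α.length = k := by
  simp only [words, Set.Finite.mem_toFinset, Set.mem_image, Set.mem_ofPred_eq]
  constructor
  · rintro ⟨l, hl, rfl⟩
    exact hl
  · intro h
    exact ⟨FreeMonoid.toList α, h, rfl⟩

/-- `X_α = X_{i₁} ⋯ X_{i_k}` for `α = g_{i₁} ⋯ g_{i_k}`, and `X_{g₀} = I`. -/
def evalWord {n : ℕ} {H : Type u} [NormedAddCommGroup H] [InnerProductSpace ℂ H]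
    (X : Fin n → H →L[ℂ] H) (α : FreeMonoid (Fin n)) : H →L[ℂ] H :=
  FreeMonoid.lift X α

/-! ### Row contractions -/

section Tuples

variable {n : ℕ} {H : Type u} [NormedAddCommGroup H] [InnerProductSpace ℂ H]

/-- The direct sum `H⁽ⁿ⁾` of `n` copies of `H`. -/
abbrev Copies (n : ℕ) (H : Type u) [NormedAddCommGroup H] [InnerProductSpace ℂ H] : Type u :=
  PiLp 2 (fun _ : Fin n => H)

/-- The row operator `[T₁ ⋯ Tₙ] : H⁽ⁿ⁾ → H`. -/
def rowOp (T : Fin n → H →L[ℂ] H) : Copies n H →L[ℂ] H :=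
  ∑ i, T i ∘L PiLp.proj 2 (fun _ : Fin n => H) i

variable [CompleteSpace H]

/-- `T₁ T₁* + ⋯ + Tₙ Tₙ* ≤ I`. -/
def IsRowContraction (T : Fin n → H →L[ℂ] H) : Prop :=
  ∑ i, T i ∘L (T i)† ≤ 1

/-- The row operator is an isometry, i.e. the `Tᵢ` are isometries with orthogonal ranges. -/
def IsRowIsometry (T : Fin n → H →L[ℂ] H) : Prop :=
  ∀ x : Copies n H, ‖rowOp T x‖ = ‖x‖

/-- `∑_{|γ| = k} ‖T_γ* h‖² → 0` for every `h`. -/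
def IsPure (T : Fin n → H →L[ℂ] H) : Prop :=
  ∀ h : H, Tendsto (fun k : ℕ => ∑ γ ∈ words n k, ‖((evalWord T γ)†) h‖ ^ 2) atTop (𝓝 0)

/-- `Δ_T = (I - ∑ Tᵢ Tᵢ*)^{1/2}`. -/
def defect (T : Fin n → H →L[ℂ] H) : H →L[ℂ] H :=
  CFC.sqrt (1 - ∑ i, T i ∘L (T i)†)

/-- `(I - A* A)^{1/2}` for a bounded operator `A` between Hilbert spaces. -/
def sqrtOneSub {E : Type v} {F : Type w} [NormedAddCommGroup E] [InnerProductSpace ℂ E]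
    [CompleteSpace E] [NormedAddCommGroup F] [InnerProductSpace ℂ F] [CompleteSpace F]
    (A : E →L[ℂ] F) : E →L[ℂ] E :=
  CFC.sqrt (1 - A† ∘L A)

/-- `Δ_{T*} = (I - T* T)^{1/2}` on `H⁽ⁿ⁾`, where `T` is the row operator. -/
def defectAdj (T : Fin n → H →L[ℂ] H) : Copies n H →L[ℂ] Copies n H :=
  sqrtOneSub (rowOp T)

/-- The defect space `𝒟_T`, the closure of `Δ_T H`. -/
def defectSpace (T : Fin n → H →L[ℂ] H) : Submodule ℂ H :=
  (LinearMap.range (defect T).toLinearMap).topologicalClosure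

/-- The defect space `𝒟_{T*}`, the closure of `Δ_{T*} H⁽ⁿ⁾`. -/
def defectAdjSpace (T : Fin n → H →L[ℂ] H) : Submodule ℂ (Copies n H) :=
  (LinearMap.range (defectAdj T).toLinearMap).topologicalClosure

/-- `𝒟_m`, the closed linear span of the `T_β Δ_T h` with `h ∈ H` and `|β| ≥ m`. -/
def spanSpace (T : Fin n → H →L[ℂ] H) (m : ℕ) : Submodule ℂ H :=
  (Submodule.span ℂ
    {x | ∃ (β : FreeMonoid (Fin n)) (h : H),
      m ≤ β.length ∧ x = evalWord T β (defect T h)}).topologicalClosure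

end Tuples

section Nilpotent

variable {n : ℕ} {H : Type u} [NormedAddCommGroup H] [InnerProductSpace ℂ H]

/-- There is `m ∈ ℕ` with `N_α = 0` for all words `α` of length `m`. -/
def IsNilpotentTuple (N : Fin n → H →L[ℂ] H) : Prop :=
  ∃ m : ℕ, ∀ α : FreeMonoid (Fin n), α.length = m → evalWord N α = 0

/-- The order of a nilpotent tuple: the smallest such `m`. -/
def nilpotentOrder (N : Fin n → H →L[ℂ] H) : ℕ :=
  sInf {m : ℕ | ∀ α : FreeMonoid (Fin n), α.length = m → evalWord N α = 0}

end Nilpotent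

/-! ### Elementary facts about row contractions -/

section Facts

variable {n : ℕ} {H : Type u} [NormedAddCommGroup H] [InnerProductSpace ℂ H] [CompleteSpace H]

theorem rowOp_apply (T : Fin n → H →L[ℂ] H) (x : Copies n H) : rowOp T x = ∑ i, T i (x i) := by
  simp [rowOp]

theorem adjoint_rowOp_apply (T : Fin n → H →L[ℂ] H) (h : H) (i : Fin n) :
    (((rowOp T)†) h) i = ((T i)†) h := by
  refine ext_inner_left ℂ fun v => ?_
  have h1 : ⟪WithLp.toLp 2 (Pi.single i v : Fin n → H), ((rowOp T)†) h⟫_ℂ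
      = ⟪v, ((T i)†) h⟫_ℂ := by
    rw [ContinuousLinearMap.adjoint_inner_right, ContinuousLinearMap.adjoint_inner_right,
      rowOp_apply, Finset.sum_eq_single i] <;> simp +contextual
  rw [← h1, PiLp.inner_apply, Finset.sum_eq_single i] <;> simp +contextual

theorem rowOp_comp_adjoint (T : Fin n → H →L[ℂ] H) :
    rowOp T ∘L (rowOp T)† = ∑ i, T i ∘L (T i)† := by
  ext h
  simp [rowOp_apply, adjoint_rowOp_apply]

theorem norm_sq_defect {T : Fin n → H →L[ℂ] H} (hT : IsRowContraction T) (h : H) :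
    ‖defect T h‖ ^ 2 = ‖h‖ ^ 2 - ∑ i, ‖((T i)†) h‖ ^ 2 := by
  have hnn : 0 ≤ 1 - ∑ i, T i ∘L (T i)† := sub_nonneg.mpr hT
  have hsa : (defect T)† = defect T :=
    (IsSelfAdjoint.of_nonneg (CFC.sqrt_nonneg _)).star_eq
  have hsq : defect T ∘L defect T = 1 - ∑ i, T i ∘L (T i)† := CFC.sqrt_mul_sqrt_self _ hnn
  have h1 : ⟪defect T h, defect T h⟫_ℂ = ⟪h, (1 - ∑ i, T i ∘L (T i)†) h⟫_ℂ := by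
    rw [← hsq, ← ContinuousLinearMap.adjoint_inner_right, hsa]; rfl
  have h2 : (⟪h, (1 - ∑ i, T i ∘L (T i)†) h⟫_ℂ) = ((‖h‖ ^ 2 - ∑ i, ‖((T i)†) h‖ ^ 2 : ℝ) : ℂ) := by
    simp only [sub_apply, one_apply_eq_self, inner_sub_right,
      sum_apply, inner_sum, ContinuousLinearMap.comp_apply]
    push_cast
    congr 1
    · exact inner_self_eq_norm_sq_to_K h
    · refine Finset.sum_congr rfl fun i _ => ?_
      rw [← ContinuousLinearMap.adjoint_inner_left]
      exact inner_self_eq_norm_sq_to_K _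
  rw [h2, inner_self_eq_norm_sq_to_K] at h1
  have h3 := congrArg Complex.re h1
  norm_cast at h3

theorem sum_words_succ {n : ℕ} (k : ℕ) (f : FreeMonoid (Fin n) → ℝ) :
    ∑ α ∈ words n (k + 1), f α = ∑ α ∈ words n k, ∑ i, f (α * FreeMonoid.of i) := by
  classical
  rw [← Finset.sum_product']
  symm
  refine Finset.sum_bij (fun p _ => p.1 * FreeMonoid.of p.2) ?_ ?_ ?_ ?_
  · intro p hp
    rw [Finset.mem_product, mem_words] at hp
    rw [mem_words, FreeMonoid.length_mul, hp.1, FreeMonoid.length_of]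
  · intro p _ q _ h
    have h' : FreeMonoid.toList p.1 ++ [p.2] = FreeMonoid.toList q.1 ++ [q.2] := h
    have := List.append_inj' h' rfl
    exact Prod.ext this.1 (by simpa using this.2)
  · intro α hα
    rw [mem_words] at hα
    have hne : FreeMonoid.toList α ≠ [] := by
      intro h0
      have : α.length = 0 := congrArg List.length h0
      omega
    refine ⟨(FreeMonoid.ofList (FreeMonoid.toList α).dropLast,
      (FreeMonoid.toList α).getLast hne), ?_, ?_⟩
    · rw [Finset.mem_product, mem_words]
      refine ⟨?_, Finset.mem_univ _⟩
      change (FreeMonoid.toList α).dropLast.length = k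
      rw [List.length_dropLast]
      change α.length - 1 = k
      omega
    · exact List.dropLast_append_getLast hne
  · intro p _
    rfl

theorem sum_words_defect {T : Fin n → H →L[ℂ] H} (hT : IsRowContraction T) (h : H) (k : ℕ) :
    ∑ α ∈ words n k, ‖defect T (((evalWord T α)†) h)‖ ^ 2
      = ∑ α ∈ words n k, ‖((evalWord T α)†) h‖ ^ 2
        - ∑ α ∈ words n (k + 1), ‖((evalWord T α)†) h‖ ^ 2 := by
  rw [sum_words_succ, ← Finset.sum_sub_distrib]
  refine Finset.sum_congr rfl fun α _ => ?_
  rw [norm_sq_defect hT]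
  congr 1
  refine Finset.sum_congr rfl fun i _ => ?_
  have : evalWord T (α * FreeMonoid.of i) = evalWord T α ∘L T i := by
    simp [evalWord, ContinuousLinearMap.mul_def]
  rw [this, ContinuousLinearMap.adjoint_comp]
  rfl

theorem sum_defect_le {T : Fin n → H →L[ℂ] H} (hT : IsRowContraction T) (h : H)
    (s : Finset (FreeMonoid (Fin n))) :
    ∑ α ∈ s, ‖defect T (((evalWord T α)†) h)‖ ^ 2 ≤ ‖h‖ ^ 2 := by
  classical
  have tele : ∀ K : ℕ, ∑ k ∈ Finset.range K, ∑ α ∈ words n k, ‖defect T (((evalWord T α)†) h)‖ ^ 2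
      = ‖h‖ ^ 2 - ∑ α ∈ words n K, ‖((evalWord T α)†) h‖ ^ 2 := by
    intro K
    induction K with
    | zero =>
      have : words n 0 = {1} := by
        ext α
        rw [mem_words, FreeMonoid.length_eq_zero, Finset.mem_singleton]
      have h1 : (ContinuousLinearMap.id ℂ H)† = ContinuousLinearMap.id ℂ H :=
        star_one (H →L[ℂ] H)
      simp [this, evalWord, ContinuousLinearMap.one_def, h1]
    | succ K ih => rw [Finset.sum_range_succ, ih, sum_words_defect hT]; ring
  set K := s.sup FreeMonoid.length + 1
  have hdisj : ∀ x ∈ Finset.range K, ∀ y ∈ Finset.range K, x ≠ y →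
      Disjoint (words n x) (words n y) := by
    intro x _ y _ hxy
    rw [Finset.disjoint_left]
    intro α ha hb
    rw [mem_words] at ha hb
    exact hxy (ha.symm.trans hb)
  have hsub : s ⊆ (Finset.range K).biUnion (words n) := by
    intro α hα
    rw [Finset.mem_biUnion]
    refine ⟨α.length, ?_, mem_words.mpr rfl⟩
    rw [Finset.mem_range]
    exact Nat.lt_succ_of_le (Finset.le_sup (f := FreeMonoid.length) hα)
  calc ∑ α ∈ s, ‖defect T (((evalWord T α)†) h)‖ ^ 2
      ≤ ∑ α ∈ (Finset.range K).biUnion (words n), ‖defect T (((evalWord T α)†) h)‖ ^ 2 :=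
        Finset.sum_le_sum_of_subset_of_nonneg hsub fun _ _ _ => by positivity
    _ = ‖h‖ ^ 2 - ∑ α ∈ words n K, ‖((evalWord T α)†) h‖ ^ 2 := by
        rw [Finset.sum_biUnion hdisj, tele]
    _ ≤ ‖h‖ ^ 2 := sub_le_self _ (Finset.sum_nonneg fun _ _ => by positivity)

theorem defect_mem (T : Fin n → H →L[ℂ] H) (h : H) : defect T h ∈ defectSpace T :=
  Submodule.le_topologicalClosure _ (LinearMap.mem_range_self _ h)

theorem norm_rowOp_le {T : Fin n → H →L[ℂ] H} (hT : IsRowContraction T) : ‖rowOp T‖ ≤ 1 := by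
  rw [← ContinuousLinearMap.adjoint.norm_map (rowOp T)]
  refine ContinuousLinearMap.opNorm_le_bound _ zero_le_one fun h => ?_
  rw [one_mul]
  refine le_of_sq_le_sq ?_ (norm_nonneg _)
  have h1 := norm_sq_defect hT h
  have h2 : ‖((rowOp T)†) h‖ ^ 2 = ∑ i, ‖((T i)†) h‖ ^ 2 := by
    rw [PiLp.norm_sq_eq_of_L2]
    simp [adjoint_rowOp_apply]
  rw [h2]
  nlinarith [sq_nonneg ‖defect T h‖]

theorem sqrtOneSub_sq {E : Type v} {F : Type w} [NormedAddCommGroup E] [InnerProductSpace ℂ E]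
    [CompleteSpace E] [NormedAddCommGroup F] [InnerProductSpace ℂ F] [CompleteSpace F]
    {A : E →L[ℂ] F} (hA : ‖A‖ ≤ 1) : sqrtOneSub A ∘L sqrtOneSub A = 1 - A† ∘L A := by
  refine CFC.sqrt_mul_sqrt_self _ ?_
  rw [ContinuousLinearMap.nonneg_iff_isPositive, ContinuousLinearMap.isPositive_def']
  refine ⟨(IsSelfAdjoint.one _).sub ?_, fun x => ?_⟩
  · exact (ContinuousLinearMap.isPositive_adjoint_comp_self A).isSelfAdjoint
  · have h1 : ‖A x‖ ≤ ‖x‖ := by simpa using A.le_of_opNorm_le hA x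
    rw [ContinuousLinearMap.reApplyInnerSelf_apply]
    simp only [sub_apply, one_apply_eq_self, inner_sub_left, ContinuousLinearMap.comp_apply,
      ContinuousLinearMap.adjoint_inner_left, map_sub, inner_self_eq_norm_sq]
    nlinarith [norm_nonneg (A x)]

theorem adjoint_sqrtOneSub {E : Type v} {F : Type w} [NormedAddCommGroup E]
    [InnerProductSpace ℂ E] [CompleteSpace E] [NormedAddCommGroup F] [InnerProductSpace ℂ F]
    [CompleteSpace F] (A : E →L[ℂ] F) : (sqrtOneSub A)† = sqrtOneSub A :=
  (IsSelfAdjoint.of_nonneg (CFC.sqrt_nonneg _)).star_eq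

/-- The row operator maps `𝒟_{T*}` into `𝒟_T`. -/
theorem rowOp_mem_defectSpace {T : Fin n → H →L[ℂ] H} (hT : IsRowContraction T)
    {x : Copies n H} (hx : x ∈ defectAdjSpace T) : rowOp T x ∈ defectSpace T := by
  have key : ∀ y : Copies n H, rowOp T (defectAdj T y) ∈ defectSpace T := by
    intro y
    rw [defectSpace, ← Submodule.orthogonal_orthogonal_eq_closure, Submodule.mem_orthogonal]
    intro k hk
    have hk0 : defect T k = 0 := by
      have h1 : ⟪defect T (defect T k), k⟫_ℂ = 0 :=
        (Submodule.mem_orthogonal _ _).mp hk _ (LinearMap.mem_range_self _ _)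
      have hsa : (defect T)† = defect T :=
        (IsSelfAdjoint.of_nonneg (CFC.sqrt_nonneg _)).star_eq
      rw [← ContinuousLinearMap.adjoint_inner_right, hsa] at h1
      exact inner_self_eq_zero.mp h1
    have hk1 : (1 - rowOp T ∘L (rowOp T)†) k = 0 := by
      have hsq : defect T ∘L defect T = 1 - ∑ i, T i ∘L (T i)† :=
        CFC.sqrt_mul_sqrt_self _ (sub_nonneg.mpr hT)
      rw [rowOp_comp_adjoint, ← hsq, ContinuousLinearMap.comp_apply, hk0, map_zero]
    have hk2 : rowOp T (((rowOp T)†) k) = k := by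
      have : k - rowOp T (((rowOp T)†) k) = 0 := hk1
      exact (sub_eq_zero.mp this).symm
    have hk3 : defectAdj T (((rowOp T)†) k) = 0 := by
      rw [← inner_self_eq_zero (𝕜 := ℂ)]
      have h2 : defectAdj T (defectAdj T (((rowOp T)†) k)) = 0 := by
        have := congrArg (fun B : Copies n H →L[ℂ] Copies n H => B (((rowOp T)†) k))
          (sqrtOneSub_sq (norm_rowOp_le hT))
        simp only [sub_apply, one_apply_eq_self, ContinuousLinearMap.comp_apply, hk2, sub_self]
          at this
        exact this
      have h3 : (defectAdj T)† = defectAdj T := adjoint_sqrtOneSub _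
      rw [← ContinuousLinearMap.adjoint_inner_right, h3, h2, inner_zero_right]
    have h3 : (defectAdj T)† = defectAdj T := adjoint_sqrtOneSub _
    rw [← ContinuousLinearMap.adjoint_inner_left, ← h3, ContinuousLinearMap.adjoint_inner_right,
      hk3, inner_zero_left]
  have hcl : IsClosed ((rowOp T) ⁻¹' (defectSpace T : Set H)) :=
    (Submodule.isClosed_topologicalClosure _).preimage (rowOp T).continuous
  have hsub : (LinearMap.range (defectAdj T).toLinearMap).topologicalClosure
      ≤ (defectSpace T).comap (rowOp T).toLinearMap := by
    refine Submodule.topologicalClosure_minimal _ ?_ hcl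
    rintro _ ⟨y, rfl⟩
    exact key y
  exact hsub hx

end Facts

/-! ### The noncommutative Poisson kernel -/

section Poisson

variable {n : ℕ} {H : Type u} [NormedAddCommGroup H] [InnerProductSpace ℂ H] [CompleteSpace H]

/-- `[B(H)ⁿ]₁⁻`, the set of all row contractions on `H`. -/
def RowBall (n : ℕ) (H : Type u) [NormedAddCommGroup H] [InnerProductSpace ℂ H]
    [CompleteSpace H] : Type u :=
  {T : Fin n → H →L[ℂ] H // IsRowContraction T}

/-- `F²(Hₙ) ⊗ K`, realised as `ℓ²(𝔽ₙ⁺, K)`: the vector `∑ e_α ⊗ x_α` is the family `(x_α)`. -/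
abbrev FockTensor (n : ℕ) (K : Type u) [NormedAddCommGroup K] [InnerProductSpace ℂ K] : Type u :=
  lp (fun _ : FreeMonoid (Fin n) => K) 2

theorem poisson_memlp (T : RowBall n H) (h : H) :
    Memℓp (fun α : FreeMonoid (Fin n) =>
      (⟨defect T.1 (((evalWord T.1 α)†) h), defect_mem T.1 _⟩ : defectSpace T.1)) 2 := by
  refine memℓp_gen' (C := ‖h‖ ^ 2) fun s => ?_
  simpa using sum_defect_le T.2 h s

/-- The noncommutative Poisson kernel `K_T h = ∑_α e_α ⊗ Δ_T T_α* h`, as an operator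
`H → F²(Hₙ) ⊗ 𝒟_T`. -/
def poissonKernel (T : RowBall n H) : H →L[ℂ] FockTensor n (defectSpace T.1) :=
  LinearMap.mkContinuous
    { toFun := fun h =>
        (⟨fun α => ⟨defect T.1 (((evalWord T.1 α)†) h), defect_mem T.1 _⟩,
          poisson_memlp T h⟩ : FockTensor n (defectSpace T.1))
      map_add' := fun x y => by
        ext α
        simp only [map_add]
        rfl
      map_smul' := fun c x => by
        ext α
        simp only [map_smul]
        rfl }
    1 fun h => by
      rw [one_mul]
      refine lp.norm_le_of_forall_sum_le (by norm_num) (norm_nonneg _) fun s => ?_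
      simpa using sum_defect_le T.2 h s

end Poisson

/-! ### The characteristic function -/

section Characteristic

/-- The Hilbert space tensor product `G ⊗ K`. -/
abbrev HTensor (G : Type u) (K : Type v) [NormedAddCommGroup G] [InnerProductSpace ℂ G]
    [NormedAddCommGroup K] [InnerProductSpace ℂ K] : Type (max u v) :=
  UniformSpace.Completion (G ⊗[ℂ] K)

/-- The operator `A ⊗ B : G ⊗ K → G ⊗ L` for `A ∈ B(G)` and `B ∈ B(K, L)`. -/
def opTensor {G : Type u} {K : Type v} {L : Type w} [NormedAddCommGroup G]
    [InnerProductSpace ℂ G] [NormedAddCommGroup K] [InnerProductSpace ℂ K]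
    [NormedAddCommGroup L] [InnerProductSpace ℂ L] (A : G →L[ℂ] G) (B : K →L[ℂ] L) :
    HTensor G K →L[ℂ] HTensor G L :=
  (TensorProduct.mapL A B).completion

/-- `X` lies in the open ball `[B(G)ⁿ]₁`. -/
def InOpenBall {n : ℕ} {G : Type w} [NormedAddCommGroup G] [InnerProductSpace ℂ G]
    [CompleteSpace G] (X : Fin n → G →L[ℂ] G) : Prop :=
  ‖∑ i, X i ∘L (X i)†‖ < 1

variable {n : ℕ} {H : Type u} [NormedAddCommGroup H] [InnerProductSpace ℂ H] [CompleteSpace H]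

/-- The restriction `T|_{𝒟_{T*}} : 𝒟_{T*} → 𝒟_T` of the row operator. -/
def rowOpRestrict (T : RowBall n H) : defectAdjSpace T.1 →L[ℂ] defectSpace T.1 :=
  (rowOp T.1 ∘L (defectAdjSpace T.1).subtypeL).codRestrict (defectSpace T.1)
    fun x => rowOp_mem_defectSpace T.2 x.2

/-- The defect operator, regarded as an operator `H → 𝒟_T`. -/
def defectCod (T : RowBall n H) : H →L[ℂ] defectSpace T.1 :=
  (defect T.1).codRestrict (defectSpace T.1) (defect_mem T.1)

/-- `Pᵢ Δ_{T*}|_{𝒟_{T*}} : 𝒟_{T*} → H`, the `i`-th component of `Δ_{T*}|_{𝒟_{T*}}`. -/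
def defectAdjComp (T : RowBall n H) (i : Fin n) : defectAdjSpace T.1 →L[ℂ] H :=
  PiLp.proj 2 (fun _ : Fin n => H) i ∘L defectAdj T.1 ∘L (defectAdjSpace T.1).subtypeL

/-- The characteristic function
`Θ_T(X) = - I ⊗ T|_{𝒟_{T*}} + (I ⊗ Δ_T) (I - ∑ Xᵢ ⊗ Tᵢ*)⁻¹ [X₁ ⊗ I, …, Xₙ ⊗ I] (I ⊗ Δ_{T*}|_{𝒟_{T*}})`
at `X ∈ [B(G)ⁿ]₁`; the operator being inverted is invertible for such `X`. -/
def charFun (T : RowBall n H) {G : Type w} [NormedAddCommGroup G] [InnerProductSpace ℂ G]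
    (X : Fin n → G →L[ℂ] G) :
    HTensor G (defectAdjSpace T.1) →L[ℂ] HTensor G (defectSpace T.1) :=
  - opTensor 1 (rowOpRestrict T)
    + opTensor 1 (defectCod T)
      ∘L Ring.inverse (1 - ∑ i, opTensor (X i) ((T.1 i)†))
      ∘L ∑ i, opTensor (X i) (ContinuousLinearMap.id ℂ H) ∘L opTensor 1 (defectAdjComp T i)

/-- `Θ_T` is a noncommutative polynomial of degree at most `m`: for some coefficients
`A_(α) ∈ B(𝒟_{T*}, 𝒟_T)`, one has `Θ_T(X) = ∑_{|α| ≤ m} X_α ⊗ A_(α)` for every `X ∈ [B(G)ⁿ]₁` and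
every Hilbert space `G`. -/
def HasCharDegreeLE (T : RowBall n H) (m : ℕ) : Prop :=
  ∃ A : FreeMonoid (Fin n) → (defectAdjSpace T.1 →L[ℂ] defectSpace T.1),
    ∀ (G : Type) [NormedAddCommGroup G] [InnerProductSpace ℂ G] [CompleteSpace G]
      (X : Fin n → G →L[ℂ] G), InOpenBall X →
      charFun T X = ∑ k ∈ Finset.range (m + 1), ∑ α ∈ words n k, opTensor (evalWord X α) (A α)

/-- `Θ_T` is a noncommutative polynomial. -/
def HasPolynomialCharFun (T : RowBall n H) : Prop :=
  ∃ m : ℕ, HasCharDegreeLE T m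

/-- `deg Θ_T ∈ ℕ ∪ {∞}`; it is `∞` if `Θ_T` is not a polynomial, and `0` if `Θ_T` is constant
(including zero). -/
def charDegree (T : RowBall n H) : ℕ∞ :=
  ⨅ (m : ℕ) (_ : HasCharDegreeLE T m), (m : ℕ∞)

/-- `Θ_T` and `Θ_{T'}` coincide, as functions on `[B(G)ⁿ]₁`: there are unitary operators
`τ₁ : 𝒟_{T*} → 𝒟_{T'*}` and `τ₂ : 𝒟_T → 𝒟_{T'}` such that
`Θ_{T'}(X) (I ⊗ τ₁) = (I ⊗ τ₂) Θ_T(X)` for all `X ∈ [B(G)ⁿ]₁`. -/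
def CharFunCoincide (G : Type w) [NormedAddCommGroup G] [InnerProductSpace ℂ G] [CompleteSpace G]
    {H' : Type v} [NormedAddCommGroup H'] [InnerProductSpace ℂ H'] [CompleteSpace H']
    (T : RowBall n H) (T' : RowBall n H') : Prop :=
  ∃ (τ₁ : defectAdjSpace T.1 ≃ₗᵢ[ℂ] defectAdjSpace T'.1)
    (τ₂ : defectSpace T.1 ≃ₗᵢ[ℂ] defectSpace T'.1),
    ∀ X : Fin n → G →L[ℂ] G, InOpenBall X →
      charFun T' X ∘L opTensor 1 (τ₁ : defectAdjSpace T.1 →L[ℂ] defectAdjSpace T'.1)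
        = opTensor 1 (τ₂ : defectSpace T.1 →L[ℂ] defectSpace T'.1) ∘L charFun T X

end Characteristic

/-! ### The invariant `Γ` and the canonical form -/

section Invariant

variable {n : ℕ} {H : Type u} [NormedAddCommGroup H] [InnerProductSpace ℂ H] [CompleteSpace H]

/-- The dimension in `ℕ ∪ {∞}` of a subspace (for closed subspaces this does not depend on whether
Hilbert or algebraic dimension is meant). -/
def dimension (S : Submodule ℂ H) : ℕ∞ :=
  Cardinal.toENat (Module.rank ℂ S)

/-- The first component of `Γ(T)`: `dim (𝒟_m ⊖ 𝒟_{m+1})` if `m = deg Θ_T` is finite, and `dim 𝒟_T`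
otherwise. -/
def gammaFst (T : RowBall n H) : ℕ∞ :=
  open Classical in
  if charDegree T = ⊤ then dimension (defectSpace T.1)
  else dimension (spanSpace T.1 (charDegree T).toNat
    ⊓ (spanSpace T.1 ((charDegree T).toNat + 1))ᗮ)

/-- `Γ(T) = (p, m, q)` with `m = deg Θ_T` and `q = dim ker K_T`. -/
def Gamma (T : RowBall n H) : ℕ∞ × ℕ∞ × ℕ∞ :=
  (gammaFst T, charDegree T, dimension (LinearMap.ker (poissonKernel T).toLinearMap))

/-- The set `ℕ_∞ × ℕ × {0}`. -/
def pureGamma : Set (ℕ∞ × ℕ∞ × ℕ∞) :=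
  Set.univ ×ˢ Set.range (fun m : ℕ => (m : ℕ∞)) ×ˢ {0}

/-- The subspace `H_v = 𝒟_m`, `m = deg Θ_T`, of the canonical representation. -/
def spaceV (T : RowBall n H) : Submodule ℂ H :=
  spanSpace T.1 (charDegree T).toNat

/-- The subspace `H_nil = 𝒟_0 ⊖ 𝒟_m`, `m = deg Θ_T`, of the canonical representation. -/
def spaceNil (T : RowBall n H) : Submodule ℂ H :=
  spanSpace T.1 0 ⊓ (spaceV T)ᗮ

instance (T : RowBall n H) : CompleteSpace (spaceV T) :=
  Submodule.topologicalClosure.completeSpace _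

instance (T : RowBall n H) : CompleteSpace (spaceNil T) :=
  IsClosed.completeSpace_coe
    (hs := (Submodule.isClosed_topologicalClosure _).inter (Submodule.isClosed_orthogonal _))

/-- The compression `P_S A|_S` of an operator to a closed subspace, i.e. its diagonal entry. -/
def compression (S : Submodule ℂ H) [CompleteSpace S] (A : H →L[ℂ] H) : S →L[ℂ] S :=
  S.orthogonalProjectionOnto ∘L A ∘L S.subtypeL

/-- The canonical representation of `T` has the form `Tᵢ = [Vᵢ *; 0 Nᵢ]` on `H = H_v ⊕ H_nil`
(orthogonal sum), where `V` is a pure isometry and `N` is a nilpotent row contraction, of order at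
most `deg Θ_T`. -/
structure HasCanonicalVNForm (T : RowBall n H) : Prop where
  ortho : spaceV T ⟂ spaceNil T
  sum_eq_top : spaceV T ⊔ spaceNil T = ⊤
  lower_left : ∀ i, ∀ x ∈ spaceV T, (spaceNil T).orthogonalProjectionOnto (T.1 i x) = 0
  rowContraction_V : IsRowContraction fun i => compression (spaceV T) (T.1 i)
  isometry_V : IsRowIsometry fun i => compression (spaceV T) (T.1 i)
  pure_V : IsPure fun i => compression (spaceV T) (T.1 i)
  rowContraction_N : IsRowContraction fun i => compression (spaceNil T) (T.1 i)
  nilpotent_N : IsNilpotentTuple fun i => compression (spaceNil T) (T.1 i)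
  order_N : (nilpotentOrder fun i => compression (spaceNil T) (T.1 i)) ≤ charDegree T

/-- `T` and `T'` are unitarily equivalent: `U Tᵢ = T'ᵢ U` for a unitary `U : H → H'`. -/
def UnitarilyEquivalent {H' : Type v} [NormedAddCommGroup H'] [InnerProductSpace ℂ H']
    [CompleteSpace H'] (T : RowBall n H) (T' : RowBall n H') : Prop :=
  ∃ U : H ≃ₗᵢ[ℂ] H', ∀ i h, U (T.1 i h) = T'.1 i (U h)

end Invariant

end RowContr

end

/-!
The argument reads everything off the coefficients of the power series of `Θ_T`. At the empty word
the coefficient is `-T|_{𝒟_{T*}}`; at `g_{i₁} ⋯ g_{i_k} g_j` it is `Δ_T T_{i₁}* ⋯ T_{i_k}* P_j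
Δ_{T*}|_{𝒟_{T*}}`. The Neumann series gives this expansion at every point where only finitely many
terms are nonzero (`charFun_eq_sum`), and nilpotent tuples of weighted partial shifts, one for
each word, isolate single coefficients (`wordTuple`). Hence `deg Θ_T ≤ m` if and only if all
coefficients at words longer than `m` vanish (`hasCharDegreeLE_iff`), and coincidence of two
characteristic functions over one infinite-dimensional space is coincidence of their coefficients
(`charCoeff_comp_of_charFun_comp`).

*Detection and the canonical form.* The coefficients beyond degree `m` vanish exactly when
`Δ_{T*}² = I - T*T` kills every copy of `𝒟_m` in `H⁽ⁿ⁾`, so that `T` is a row isometry on its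
invariant subspace `𝒟_m` (`adjoint_apply_of_mem_spanSpace`). If moreover `ker K_T = 0`, then this
row isometry has no unitary part: a vector of `𝒟_m` on which its sums `∑_{|γ| = k} ‖V_γ* x‖²` stay
equal to `‖x‖²` is in `ker K_T`. By the Wold decomposition it is pure (`IsRowIsometry.isPure`).
Since `𝒟_0 = (ker K_T)ᗮ` is everything, each `T_α` with `|α| = m` maps into `𝒟_m`; this makes the
compression of `T` to `𝒟_mᗮ` nilpotent and carries purity from `𝒟_m` over to `T`
(`isPure_of_compression`). Conversely purity forces `ker K_T = 0`.

*Classification.* The identity `I - K_T K_T* = Θ Θ*` on the Fock space says, entry by entry, that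
the inner products `⟨T_β Δ_T d, T_α Δ_T d'⟩` are determined recursively by the inner products of
the adjoint coefficients applied to `d` and `d'` (`inner_gramVec_of_mul_of_mul` and its
companions, which rest on the intertwining relation `T Δ_{T*} = Δ_T T` of `rowOp_defectAdj`). So
coinciding characteristic functions give vectors `T_β Δ_T d` and `T'_β Δ_{T'} τ₂ d` with equal
Gram matrices. If both Poisson kernels are injective, these vectors span dense subspaces, and `T_β
Δ_T d ↦ T'_β Δ_{T'} τ₂ d` extends to a unitary intertwining `T` and `T'`
(`unitarilyEquivalent_of_revCoeff`). The converse transports defect operators, coefficients and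
the subspaces `𝒟_m` along the unitary.
-/

noncomputable section

namespace RowContr

universe u v w x

/-! ### Words and products along words -/

section Words

variable {n : ℕ}

theorem words_zero : words n 0 = {1} := by
  ext α
  rw [mem_words, FreeMonoid.length_eq_zero, Finset.mem_singleton]

theorem sum_words_append {M : Type*} [AddCommMonoid M] (k : ℕ) (f : FreeMonoid (Fin n) → M) :
    ∑ α ∈ words n (k + 1), f α = ∑ α ∈ words n k, ∑ i, f (α * FreeMonoid.of i) := by
  classical
  rw [← Finset.sum_product']
  symm
  refine Finset.sum_bij (fun p _ => p.1 * FreeMonoid.of p.2) ?_ ?_ ?_ fun _ _ => rfl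
  · intro p hp
    rw [Finset.mem_product, mem_words] at hp
    rw [mem_words, FreeMonoid.length_mul, hp.1, FreeMonoid.length_of]
  · intro p _ q _ h
    have h' : FreeMonoid.toList p.1 ++ [p.2] = FreeMonoid.toList q.1 ++ [q.2] := h
    have := List.append_inj' h' rfl
    exact Prod.ext this.1 (by simpa using this.2)
  · intro α hα
    rw [mem_words] at hα
    rcases List.eq_nil_or_concat' (FreeMonoid.toList α) with h0 | ⟨l, i, h⟩
    · have : α.length = 0 := congrArg List.length h0
      omega
    · have hl : α.length = l.length + 1 := by
        exact (congrArg List.length h).trans (by simp)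
      exact ⟨(FreeMonoid.ofList l, i),
        Finset.mem_product.mpr ⟨mem_words.mpr (show l.length = k by omega), Finset.mem_univ _⟩,
        h.symm⟩

theorem sum_words_add {M : Type*} [AddCommMonoid M] (k m : ℕ) (f : FreeMonoid (Fin n) → M) :
    ∑ α ∈ words n (k + m), f α = ∑ α ∈ words n k, ∑ β ∈ words n m, f (α * β) := by
  induction m generalizing f with
  | zero => simp [words_zero]
  | succ m ih =>
    rw [← add_assoc, sum_words_append, ih]
    simp_rw [sum_words_append, mul_assoc]

variable {E : Type u} [NormedAddCommGroup E] [InnerProductSpace ℂ E]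

@[simp] theorem evalWord_one (X : Fin n → E →L[ℂ] E) : evalWord X 1 = 1 := map_one _

@[simp] theorem evalWord_of (X : Fin n → E →L[ℂ] E) (i : Fin n) :
    evalWord X (FreeMonoid.of i) = X i := FreeMonoid.lift_eval_of _ _

theorem evalWord_mul (X : Fin n → E →L[ℂ] E) (α β : FreeMonoid (Fin n)) :
    evalWord X (α * β) = evalWord X α ∘L evalWord X β := map_mul _ _ _

theorem evalWord_mul_apply (X : Fin n → E →L[ℂ] E) (α β : FreeMonoid (Fin n)) (h : E) :
    evalWord X (α * β) h = evalWord X α (evalWord X β h) := by rw [evalWord_mul]; rfl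

variable [CompleteSpace E]

theorem adjoint_one : (1 : E →L[ℂ] E)† = 1 := star_one _

theorem adjoint_evalWord_mul_apply (X : Fin n → E →L[ℂ] E) (α β : FreeMonoid (Fin n)) (h : E) :
    ((evalWord X (α * β))†) h = ((evalWord X β)†) (((evalWord X α)†) h) := by
  rw [evalWord_mul, ContinuousLinearMap.adjoint_comp]; rfl

theorem adjoint_evalWord (X : Fin n → E →L[ℂ] E) (α : FreeMonoid (Fin n)) :
    (evalWord X α)† = evalWord (fun i => (X i)†) α.reverse := by
  induction α using FreeMonoid.inductionOn' with
  | one => simp [adjoint_one, show FreeMonoid.reverse (1 : FreeMonoid (Fin n)) = 1 from rfl]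
  | of_mul i α ih =>
    rw [FreeMonoid.reverse_mul, evalWord_mul, evalWord_mul, ContinuousLinearMap.adjoint_comp, ih]
    simp

end Words

/-! ### Operators on Hilbert space tensor products -/

section Tensor

variable {G : Type u} {K : Type v} {L : Type w} {M : Type x}
  [NormedAddCommGroup G] [InnerProductSpace ℂ G] [NormedAddCommGroup K] [InnerProductSpace ℂ K]
  [NormedAddCommGroup L] [InnerProductSpace ℂ L] [NormedAddCommGroup M] [InnerProductSpace ℂ M]

/-- The elementary tensor `g ⊗ k` in the Hilbert space tensor product. -/
def tmulH (g : G) (k : K) : HTensor G K := ((g ⊗ₜ[ℂ] k : G ⊗[ℂ] K) : HTensor G K)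

theorem inner_tmulH (g g' : G) (k k' : K) :
    ⟪tmulH g k, tmulH g' k'⟫_ℂ = ⟪g, g'⟫_ℂ * ⟪k, k'⟫_ℂ := by
  rw [tmulH, tmulH, UniformSpace.Completion.inner_coe, TensorProduct.inner_tmul]

@[simp] theorem opTensor_tmulH (A : G →L[ℂ] G) (B : K →L[ℂ] L) (g : G) (k : K) :
    opTensor A B (tmulH g k) = tmulH (A g) (B k) := by
  simp only [opTensor, tmulH, ContinuousLinearMap.completion_apply_coe, TensorProduct.mapL_tmul]

theorem ext_tmulH {F : Type*} [NormedAddCommGroup F] [InnerProductSpace ℂ F]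
    {A B : HTensor G K →L[ℂ] F} (h : ∀ g k, A (tmulH g k) = B (tmulH g k)) : A = B := by
  ext z
  induction z using UniformSpace.Completion.induction_on with
  | hp => exact isClosed_eq A.continuous B.continuous
  | ih z =>
    induction z using TensorProduct.induction_on with
    | zero => exact (map_zero A).trans (map_zero B).symm
    | tmul g k => exact h g k
    | add y z hy hz => rw [UniformSpace.Completion.coe_add, map_add, map_add, hy, hz]

theorem tmulH_zero_left (k : K) : tmulH (0 : G) k = 0 := by simp [tmulH]

theorem tmulH_zero_right (g : G) : tmulH g (0 : K) = 0 := by simp [tmulH]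

theorem tmulH_add_left (g g' : G) (k : K) : tmulH (g + g') k = tmulH g k + tmulH g' k := by
  rw [tmulH, TensorProduct.add_tmul, UniformSpace.Completion.coe_add]; rfl

theorem tmulH_neg_right (g : G) (k : K) : tmulH g (-k) = -tmulH g k := by
  rw [tmulH, TensorProduct.tmul_neg, UniformSpace.Completion.coe_neg]; rfl

theorem tmulH_add_right (g : G) (k k' : K) : tmulH g (k + k') = tmulH g k + tmulH g k' := by
  rw [tmulH, TensorProduct.tmul_add, UniformSpace.Completion.coe_add]; rfl

theorem tmulH_sum_left {ι : Type*} (s : Finset ι) (g : ι → G) (k : K) :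
    tmulH (∑ i ∈ s, g i) k = ∑ i ∈ s, tmulH (g i) k := by
  classical
  induction s using Finset.induction_on with
  | empty => simp [tmulH_zero_left]
  | insert i s hi ih => rw [Finset.sum_insert hi, Finset.sum_insert hi, tmulH_add_left, ih]

theorem tmulH_sum_right {ι : Type*} (s : Finset ι) (g : G) (k : ι → K) :
    tmulH g (∑ i ∈ s, k i) = ∑ i ∈ s, tmulH g (k i) := by
  classical
  induction s using Finset.induction_on with
  | empty => simp [tmulH_zero_right]
  | insert i s hi ih => rw [Finset.sum_insert hi, Finset.sum_insert hi, tmulH_add_right, ih]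

theorem opTensor_comp (A A' : G →L[ℂ] G) (B : L →L[ℂ] M) (B' : K →L[ℂ] L) :
    opTensor A B ∘L opTensor A' B' = opTensor (A ∘L A') (B ∘L B') :=
  ext_tmulH fun g k => by simp

theorem opTensor_sum_left {ι : Type*} (s : Finset ι) (A : ι → G →L[ℂ] G) (B : K →L[ℂ] L) :
    opTensor (∑ i ∈ s, A i) B = ∑ i ∈ s, opTensor (A i) B :=
  ext_tmulH fun g k => by simp [tmulH_sum_left]

theorem opTensor_sum_right {ι : Type*} (s : Finset ι) (A : G →L[ℂ] G) (B : ι → K →L[ℂ] L) :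
    opTensor A (∑ i ∈ s, B i) = ∑ i ∈ s, opTensor A (B i) :=
  ext_tmulH fun g k => by simp [tmulH_sum_right]

theorem opTensor_neg_right (A : G →L[ℂ] G) (B : K →L[ℂ] L) : opTensor A (-B) = -opTensor A B :=
  ext_tmulH fun g k => by simp [tmulH_neg_right]

theorem opTensor_zero_left (B : K →L[ℂ] L) : opTensor (0 : G →L[ℂ] G) B = 0 :=
  ext_tmulH fun g k => by simp [tmulH_zero_left]

theorem opTensor_zero_right (A : G →L[ℂ] G) : opTensor A (0 : K →L[ℂ] L) = 0 :=
  ext_tmulH fun g k => by simp [tmulH_zero_right]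

theorem opTensor_one_one : opTensor (1 : G →L[ℂ] G) (1 : K →L[ℂ] K) = 1 :=
  ext_tmulH fun g k => by simp

theorem norm_opTensor_le (A : G →L[ℂ] G) (B : K →L[ℂ] L) : ‖opTensor A B‖ ≤ ‖A‖ * ‖B‖ := by
  refine ContinuousLinearMap.opNorm_le_bound _ (by positivity) fun z => ?_
  induction z using UniformSpace.Completion.induction_on with
  | hp => exact isClosed_le (by fun_prop) (by fun_prop)
  | ih z =>
    rw [opTensor, ContinuousLinearMap.completion_apply_coe, UniformSpace.Completion.norm_coe,
      UniformSpace.Completion.norm_coe]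
    exact (TensorProduct.mapL A B).le_of_opNorm_le (TensorProduct.norm_mapL_le A B) z

theorem adjoint_opTensor [CompleteSpace G] [CompleteSpace K] [CompleteSpace L]
    (A : G →L[ℂ] G) (B : K →L[ℂ] L) : (opTensor A B)† = opTensor (A†) (B†) := by
  refine ext_tmulH fun g k => ?_
  refine ext_inner_right ℂ fun z => ?_
  rw [ContinuousLinearMap.adjoint_inner_left]
  suffices h : (innerSL ℂ (tmulH g k)) ∘L opTensor A B
      = innerSL ℂ (opTensor (A†) (B†) (tmulH g k)) by
    simpa using congrArg (fun F : HTensor G K →L[ℂ] ℂ => F z) h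
  refine ext_tmulH fun g' k' => ?_
  simp only [ContinuousLinearMap.comp_apply, opTensor_tmulH, innerSL_apply_apply, inner_tmulH,
    ContinuousLinearMap.adjoint_inner_left]

end Tensor

section Neumann

variable {n : ℕ} {G : Type w} {H : Type u}
  [NormedAddCommGroup G] [InnerProductSpace ℂ G] [NormedAddCommGroup H] [InnerProductSpace ℂ H]

theorem sum_opTensor_pow (X : Fin n → G →L[ℂ] G) (Y : Fin n → H →L[ℂ] H) (k : ℕ) :
    (∑ i, opTensor (X i) (Y i)) ^ k
      = ∑ α ∈ words n k, opTensor (evalWord X α) (evalWord Y α) := by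
  induction k with
  | zero => simp [words_zero, opTensor_one_one]
  | succ k ih =>
    rw [pow_succ, ih, sum_words_append, Finset.sum_mul]
    refine Finset.sum_congr rfl fun α _ => ?_
    rw [Finset.mul_sum]
    refine Finset.sum_congr rfl fun i _ => ?_
    rw [ContinuousLinearMap.mul_def, opTensor_comp, evalWord_mul, evalWord_mul, evalWord_of,
      evalWord_of]

theorem sum_norm_sq_adjoint_le {ι : Type*} (s : Finset ι) {E : Type*} [NormedAddCommGroup E]
    [InnerProductSpace ℂ E] [CompleteSpace E] (A : ι → E →L[ℂ] E) (z : E) :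
    ∑ i ∈ s, ‖((A i)†) z‖ ^ 2 ≤ ‖∑ i ∈ s, A i ∘L (A i)†‖ * ‖z‖ ^ 2 := by
  have h : ∑ i ∈ s, ‖((A i)†) z‖ ^ 2 = RCLike.re ⟪z, (∑ i ∈ s, A i ∘L (A i)†) z⟫_ℂ := by
    simp only [sum_apply, inner_sum, map_sum, ContinuousLinearMap.comp_apply]
    refine Finset.sum_congr rfl fun i _ => ?_
    rw [← ContinuousLinearMap.adjoint_inner_left, inner_self_eq_norm_sq]
  rw [h]
  calc _ ≤ ‖z‖ * ‖(∑ i ∈ s, A i ∘L (A i)†) z‖ :=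
        (re_inner_le_norm _ _)
    _ ≤ ‖z‖ * (‖∑ i ∈ s, A i ∘L (A i)†‖ * ‖z‖) := by
        gcongr; exact ContinuousLinearMap.le_opNorm _ _
    _ = _ := by ring

/-- Since `∑ Xᵢ ⊗ Tᵢ*` factors through the row `[Xᵢ ⊗ I]`, of norm `< 1`, and the column
`[I ⊗ Tᵢ*]`, of norm `≤ 1`, it is a strict contraction. -/
theorem norm_sum_opTensor_adjoint_lt_one [CompleteSpace G] [CompleteSpace H]
    {X : Fin n → G →L[ℂ] G} (hX : InOpenBall X) {T : Fin n → H →L[ℂ] H}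
    (hT : IsRowContraction T) : ‖∑ i, opTensor (X i) ((T i)†)‖ < 1 := by
  set c := ‖∑ i, X i ∘L (X i)†‖ with hc
  have hc1 : c < 1 := hX
  have hone : ∀ (E : Type w) [NormedAddCommGroup E] [InnerProductSpace ℂ E],
      ‖(1 : E →L[ℂ] E)‖ ≤ 1 := fun E _ _ => ContinuousLinearMap.norm_id_le
  have hone' : ‖(1 : H →L[ℂ] H)‖ ≤ 1 := ContinuousLinearMap.norm_id_le
  have hTn : ‖∑ i, T i ∘L (T i)†‖ ≤ 1 := by
    rw [← rowOp_comp_adjoint]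
    refine (ContinuousLinearMap.opNorm_comp_le _ _).trans ?_
    rw [ContinuousLinearMap.adjoint.norm_map]
    exact mul_le_one₀ (norm_rowOp_le hT) (norm_nonneg _) (norm_rowOp_le hT)
  refine lt_of_le_of_lt (b := √c) (ContinuousLinearMap.opNorm_le_bound _ (Real.sqrt_nonneg _)
    fun z => ?_) (by rw [Real.sqrt_lt' one_pos]; simpa using hc1)
  set y := (∑ i, opTensor (X i) ((T i)†)) z with hy
  -- the two factors of the Cauchy-Schwarz estimate
  have hu : ∑ i, ‖((opTensor (X i) (1 : H →L[ℂ] H))†) y‖ ^ 2 ≤ c * ‖y‖ ^ 2 := by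
    refine (sum_norm_sq_adjoint_le _ _ _).trans ?_
    have : ∑ i, opTensor (X i) (1 : H →L[ℂ] H) ∘L (opTensor (X i) (1 : H →L[ℂ] H))†
        = opTensor (∑ i, X i ∘L (X i)†) 1 := by
      simp only [adjoint_opTensor, opTensor_comp, adjoint_one, opTensor_sum_left]
      rfl
    rw [this]
    gcongr
    refine (norm_opTensor_le _ _).trans ?_
    exact mul_le_of_le_one_right (norm_nonneg _) hone'
  have hz : ∑ i, ‖opTensor (1 : G →L[ℂ] G) ((T i)†) z‖ ^ 2 ≤ ‖z‖ ^ 2 := by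
    have h1 : ∀ i, opTensor (1 : G →L[ℂ] G) ((T i)†) = (opTensor 1 (T i))† := fun i => by
      rw [adjoint_opTensor, adjoint_one]
    simp only [h1]
    refine (sum_norm_sq_adjoint_le _ _ _).trans ?_
    have : ∑ i, opTensor (1 : G →L[ℂ] G) (T i) ∘L (opTensor (1 : G →L[ℂ] G) (T i))†
        = opTensor 1 (∑ i, T i ∘L (T i)†) := by
      simp only [adjoint_opTensor, opTensor_comp, adjoint_one, opTensor_sum_right]
      rfl
    rw [this]
    refine mul_le_of_le_one_left (by positivity) ((norm_opTensor_le _ _).trans ?_)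
    exact mul_le_one₀ (hone G) (norm_nonneg _) hTn
  have hyy : ‖y‖ ^ 2 ≤ ∑ i, ‖((opTensor (X i) (1 : H →L[ℂ] H))†) y‖
      * ‖opTensor (1 : G →L[ℂ] G) ((T i)†) z‖ := by
    have h1 : y = ∑ i, opTensor (X i) (1 : H →L[ℂ] H) (opTensor (1 : G →L[ℂ] G) ((T i)†) z) := by
      rw [hy, sum_apply]
      refine Finset.sum_congr rfl fun i _ => ?_
      rw [← ContinuousLinearMap.comp_apply, opTensor_comp]
      rfl
    have h2 : ‖y‖ ^ 2 = RCLike.re (∑ i, ⟪((opTensor (X i) (1 : H →L[ℂ] H))†) y,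
        opTensor (1 : G →L[ℂ] G) ((T i)†) z⟫_ℂ) := by
      simp only [ContinuousLinearMap.adjoint_inner_left]
      rw [← inner_sum, ← h1, inner_self_eq_norm_sq]
    rw [h2, map_sum]
    exact Finset.sum_le_sum fun i _ => re_inner_le_norm _ _
  have hcs := Finset.sum_mul_sq_le_sq_mul_sq Finset.univ
    (fun i => ‖((opTensor (X i) (1 : H →L[ℂ] H))†) y‖)
    (fun i => ‖opTensor (1 : G →L[ℂ] G) ((T i)†) z‖)
  have hc0 : 0 ≤ c := norm_nonneg _
  have hfin : (‖y‖ ^ 2) ^ 2 ≤ c * ‖y‖ ^ 2 * ‖z‖ ^ 2 := by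
    calc (‖y‖ ^ 2) ^ 2 ≤ _ := pow_le_pow_left₀ (by positivity) hyy 2
      _ ≤ _ := hcs
      _ ≤ _ := by gcongr
  have hsq : ‖y‖ ^ 2 ≤ (√c * ‖z‖) ^ 2 := by
    rw [mul_pow, Real.sq_sqrt hc0]
    rcases (sq_nonneg ‖y‖).eq_or_lt with h0 | h0
    · rw [← h0]; positivity
    · refine le_of_mul_le_mul_left ?_ h0
      linarith
  exact le_of_sq_le_sq hsq (by positivity)

theorem comp_inverse_one_sub_comp {E : Type*} {F : Type*} {C : Type*} [NormedAddCommGroup E]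
    [InnerProductSpace ℂ E] [CompleteSpace E] [NormedAddCommGroup F] [InnerProductSpace ℂ F]
    [NormedAddCommGroup C] [InnerProductSpace ℂ C] {a : E →L[ℂ] E} (ha : ‖a‖ < 1)
    (D : E →L[ℂ] F) (B : C →L[ℂ] E) {S : ℕ → C →L[ℂ] F} (hS : ∀ k, D ∘L (a ^ k) ∘L B = S k)
    (N : ℕ) (h : ∀ k, N ≤ k → S k = 0) :
    D ∘L Ring.inverse (1 - a) ∘L B = ∑ k ∈ Finset.range N, S k := by
  have h1 : HasSum (fun k : ℕ => a ^ k) (Ring.inverse (1 - a)) := by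
    rw [NormedRing.inverse_one_sub a ha]
    exact (summable_geometric_of_norm_lt_one ha).hasSum
  have h2 : HasSum (fun k : ℕ => D ∘L (a ^ k) ∘L B) (D ∘L Ring.inverse (1 - a) ∘L B) :=
    h1.mapL ((ContinuousLinearMap.compL ℂ C E F D) ∘L
      ((ContinuousLinearMap.compL ℂ C E E).flip B))
  rw [funext hS] at h2
  refine h2.unique (hasSum_sum_of_ne_finset_zero fun k hk => h k ?_)
  simpa using hk

/-- The Neumann expansion for operators on Hilbert space tensor products. -/
theorem one_sub_inverse_expand {G : Type w} [NormedAddCommGroup G]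
    [InnerProductSpace ℂ G] {K : Type v} {L : Type x} [NormedAddCommGroup K] [InnerProductSpace ℂ K]
    [NormedAddCommGroup L] [InnerProductSpace ℂ L] {a : HTensor G H →L[ℂ] HTensor G H}
    (ha : ‖a‖ < 1) (D : HTensor G H →L[ℂ] HTensor G L) (B : HTensor G K →L[ℂ] HTensor G H)
    {S : ℕ → HTensor G K →L[ℂ] HTensor G L}
    (hS : ∀ k, D ∘L (a ^ k) ∘L B = S k) (N : ℕ) (h : ∀ k, N ≤ k → S k = 0) :
    D ∘L Ring.inverse (1 - a) ∘L B = ∑ k ∈ Finset.range N, S k :=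
  comp_inverse_one_sub_comp ha D B hS N h

end Neumann

/-! ### Coefficients of the characteristic function -/

section Coefficients

variable {n : ℕ} {H : Type u} [NormedAddCommGroup H] [InnerProductSpace ℂ H] [CompleteSpace H]

/-- The operator `Δ_T T_α* P_j Δ_{T*}|_{𝒟_{T*}}` attached to the word `g_j α`, and
`-T|_{𝒟_{T*}}` attached to the empty word. It is the coefficient of `Θ_T` at the reversed word. -/
def revCoeff (T : RowBall n H) (α : FreeMonoid (Fin n)) :
    defectAdjSpace T.1 →L[ℂ] defectSpace T.1 :=
  match FreeMonoid.toList α with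
  | [] => -rowOpRestrict T
  | j :: l => defectCod T ∘L (evalWord T.1 (FreeMonoid.ofList l))† ∘L defectAdjComp T j

/-- The coefficient `A_(α)` of `Θ_T(X) = ∑ X_α ⊗ A_(α)`. -/
def charCoeff (T : RowBall n H) (α : FreeMonoid (Fin n)) :
    defectAdjSpace T.1 →L[ℂ] defectSpace T.1 :=
  revCoeff T α.reverse

theorem revCoeff_of_mul (T : RowBall n H) (j : Fin n) (α : FreeMonoid (Fin n)) :
    revCoeff T (FreeMonoid.of j * α)
      = defectCod T ∘L (evalWord T.1 α)† ∘L defectAdjComp T j := rfl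

theorem charCoeff_one (T : RowBall n H) : charCoeff T 1 = -rowOpRestrict T := rfl

theorem charCoeff_mul_of (T : RowBall n H) (α : FreeMonoid (Fin n)) (j : Fin n) :
    charCoeff T (α * FreeMonoid.of j)
      = defectCod T ∘L evalWord (fun i => (T.1 i)†) α ∘L defectAdjComp T j := by
  rw [charCoeff, FreeMonoid.reverse_mul, FreeMonoid.reverse_of, revCoeff_of_mul,
    adjoint_evalWord, FreeMonoid.reverse_reverse]

theorem charFun_term (T : RowBall n H) {G : Type w} [NormedAddCommGroup G]
    [InnerProductSpace ℂ G] (X : Fin n → G →L[ℂ] G) (k : ℕ) :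
    opTensor 1 (defectCod T) ∘L ((∑ i, opTensor (X i) ((T.1 i)†)) ^ k) ∘L
      (∑ i, opTensor (X i) (ContinuousLinearMap.id ℂ H) ∘L opTensor 1 (defectAdjComp T i))
      = ∑ α ∈ words n (k + 1), opTensor (evalWord X α) (charCoeff T α) := by
  rw [sum_opTensor_pow, sum_words_append, ContinuousLinearMap.finsetSum_comp,
    ContinuousLinearMap.comp_finsetSum]
  refine Finset.sum_congr rfl fun α _ => ?_
  rw [ContinuousLinearMap.comp_finsetSum, ContinuousLinearMap.comp_finsetSum]
  refine Finset.sum_congr rfl fun i _ => ?_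
  rw [opTensor_comp, opTensor_comp, opTensor_comp, charCoeff_mul_of, evalWord_mul, evalWord_of]
  rfl

/-- The power series of `Θ_T`, at a point `X` at which all its terms of degree above `N` vanish. -/
theorem charFun_eq_sum (T : RowBall n H) {G : Type w} [NormedAddCommGroup G]
    [InnerProductSpace ℂ G] [CompleteSpace G] {X : Fin n → G →L[ℂ] G} (hX : InOpenBall X) (N : ℕ)
    (h : ∀ α : FreeMonoid (Fin n), N < α.length →
      opTensor (evalWord X α) (charCoeff T α) = 0) :
    charFun T X = ∑ k ∈ Finset.range (N + 1), ∑ α ∈ words n k,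
      opTensor (evalWord X α) (charCoeff T α) := by
  have h0 : ∀ k, N ≤ k →
      ∑ α ∈ words n (k + 1), opTensor (evalWord X α) (charCoeff T α) = 0 := by
    intro k hk
    refine Finset.sum_eq_zero fun α hα => h α ?_
    have := mem_words.mp hα
    omega
  rw [charFun, Finset.sum_range_succ', add_comm]
  refine congrArg₂ _ (one_sub_inverse_expand (norm_sum_opTensor_adjoint_lt_one hX T.2) _ _
    (charFun_term T X) N h0) ?_
  rw [words_zero, Finset.sum_singleton, charCoeff_one, evalWord_one, opTensor_neg_right]

end Coefficients

/-! ### Test tuples separating words -/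

section WordTuple

variable {n : ℕ} {G : Type w} [NormedAddCommGroup G] [InnerProductSpace ℂ G]

/-- For a word `a = g_{l₀} ⋯ g_{l_{K-1}}`, the tuple of weighted partial shifts
`Xᵢ = r ∑_{l_j = i} |e_j⟩⟨e_{j+1}|`. If `e` is orthonormal, then among all words `β` only `β = a`
gives a nonzero matrix entry `⟨e₀, X_β e_K⟩`. -/
def wordTuple (e : ℕ → G) (r : ℝ) (a : FreeMonoid (Fin n)) (i : Fin n) : G →L[ℂ] G :=
  ∑ j ∈ Finset.range a.length,
    if (FreeMonoid.toList a)[j]? = some i then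
      (r : ℂ) • (innerSL ℂ (e (j + 1))).smulRight (e j) else 0

theorem wordTuple_apply (e : ℕ → G) (r : ℝ) (a : FreeMonoid (Fin n)) (i : Fin n) (y : G) :
    wordTuple e r a i y = ∑ j ∈ Finset.range a.length,
      if (FreeMonoid.toList a)[j]? = some i then ((r : ℂ) * ⟪e (j + 1), y⟫_ℂ) • e j else 0 := by
  rw [wordTuple, sum_apply]
  refine Finset.sum_congr rfl fun j _ => ?_
  split_ifs <;> simp [mul_smul]

theorem inner_wordTuple {e : ℕ → G} (he : Orthonormal ℂ e) (r : ℝ) (a : FreeMonoid (Fin n))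
    (i : Fin n) (j : ℕ) (y : G) :
    ⟪e j, wordTuple e r a i y⟫_ℂ
      = if (FreeMonoid.toList a)[j]? = some i then (r : ℂ) * ⟪e (j + 1), y⟫_ℂ else 0 := by
  rw [wordTuple_apply, inner_sum]
  have hterm : ∀ k ∈ Finset.range a.length, ⟪e j, if (FreeMonoid.toList a)[k]? = some i then
      ((r : ℂ) * ⟪e (k + 1), y⟫_ℂ) • e k else 0⟫_ℂ
      = if j = k then (if (FreeMonoid.toList a)[j]? = some i then
        (r : ℂ) * ⟪e (j + 1), y⟫_ℂ else 0) else 0 := by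
    intro k _
    by_cases hjk : j = k
    · subst hjk
      rw [if_pos rfl]
      split_ifs <;> simp [inner_self_eq_norm_sq_to_K, he.norm_eq_one]
    · rw [if_neg hjk]
      split_ifs <;> simp [he.inner_eq_zero hjk]
  rw [Finset.sum_congr rfl hterm, Finset.sum_ite_eq]
  split_ifs with h1 h2 h2
  · rfl
  · rfl
  · exact absurd (Finset.mem_range.mpr (List.getElem?_eq_some_iff.mp h2).1) h1
  · rfl

theorem inner_evalWord_wordTuple {e : ℕ → G} (he : Orthonormal ℂ e) (r : ℝ)
    (a β : FreeMonoid (Fin n)) (j : ℕ) (y : G) :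
    ⟪e j, evalWord (wordTuple e r a) β y⟫_ℂ
      = open Classical in if FreeMonoid.toList β <+: (FreeMonoid.toList a).drop j then
        (r : ℂ) ^ β.length * ⟪e (j + β.length), y⟫_ℂ else 0 := by
  classical
  induction β using FreeMonoid.inductionOn' generalizing j with
  | one => simp
  | of_mul i β ih =>
    rw [evalWord_mul_apply, evalWord_of, inner_wordTuple he, ih, FreeMonoid.toList_of_mul,
      FreeMonoid.length_mul, FreeMonoid.length_of]
    have hpre : i :: FreeMonoid.toList β <+: (FreeMonoid.toList a).drop j
        ↔ (FreeMonoid.toList a)[j]? = some i ∧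
          FreeMonoid.toList β <+: (FreeMonoid.toList a).drop (j + 1) := by
      by_cases hj : j < (FreeMonoid.toList a).length
      · rw [List.drop_eq_getElem_cons hj, List.cons_prefix_cons, List.getElem?_eq_getElem hj,
          Option.some_inj, eq_comm]
      · rw [List.drop_eq_nil_of_le (not_lt.mp hj), List.getElem?_eq_none (not_lt.mp hj)]
        simp
    by_cases h1 : (FreeMonoid.toList a)[j]? = some i <;>
    by_cases h2 : FreeMonoid.toList β <+: (FreeMonoid.toList a).drop (j + 1) <;>
    simp only [hpre, h1, h2, if_true, if_false, and_true, and_false, mul_zero]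
    rw [← mul_assoc, ← pow_succ', add_comm 1 β.length, add_assoc, add_comm 1 β.length]

theorem inner_evalWord_wordTuple_last {e : ℕ → G} (he : Orthonormal ℂ e) (r : ℝ)
    (a β : FreeMonoid (Fin n)) :
    ⟪e 0, evalWord (wordTuple e r a) β (e a.length)⟫_ℂ
      = open Classical in if β = a then (r : ℂ) ^ a.length else 0 := by
  classical
  rw [inner_evalWord_wordTuple he, List.drop_zero, zero_add]
  by_cases hβ : β = a
  · subst hβ
    simp [inner_self_eq_norm_sq_to_K, he.norm_eq_one]
  · rw [if_neg hβ]
    split_ifs with h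
    · rw [he.inner_eq_zero, mul_zero]
      intro hl
      exact hβ (h.eq_of_length hl)
    · rfl

theorem evalWord_wordTuple_eq_zero {e : ℕ → G} (he : Orthonormal ℂ e) (r : ℝ)
    {a β : FreeMonoid (Fin n)} (h : a.length < β.length) :
    evalWord (wordTuple e r a) β = 0 := by
  classical
  induction β using FreeMonoid.inductionOn' with
  | one => exact absurd h (Nat.not_lt_zero _)
  | of_mul i β _ =>
    ext y
    rw [evalWord_mul_apply, evalWord_of, wordTuple_apply]
    refine Finset.sum_eq_zero fun j hj => ?_
    have hin : ⟪e (j + 1), evalWord (wordTuple e r a) β y⟫_ℂ = 0 := by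
      rw [inner_evalWord_wordTuple he, if_neg]
      intro hpre
      have h1 := hpre.length_le
      have h2 : β.length ≤ a.length - (j + 1) := h1.trans_eq List.length_drop
      rw [FreeMonoid.length_mul, FreeMonoid.length_of] at h
      have := Finset.mem_range.mp hj
      omega
    rw [hin, mul_zero, zero_smul, ite_self]

theorem exists_wordTuple_inOpenBall [CompleteSpace G] {e : ℕ → G} (he : Orthonormal ℂ e)
    (a : FreeMonoid (Fin n)) : ∃ r : ℝ, 0 < r ∧ InOpenBall (wordTuple e r a) := by
  set K := a.length with hK
  -- each entry is a sum of `K` rank-one operators of norm `r`, and there are `n` entries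
  refine ⟨1 / ((n + 1) * (K + 1)), by positivity, ?_⟩
  set r : ℝ := 1 / ((n + 1) * (K + 1)) with hr
  have hr0 : 0 < r := by positivity
  have hnorm : ∀ i, ‖wordTuple e r a i‖ ≤ 1 / (n + 1) := by
    intro i
    calc ‖wordTuple e r a i‖ ≤ ∑ j ∈ Finset.range K, r := by
          refine norm_sum_le_of_le _ fun j _ => ?_
          split_ifs
          · rw [norm_smul, ContinuousLinearMap.norm_smulRight_apply, innerSL_apply_norm,
              he.norm_eq_one, he.norm_eq_one]
            simp [abs_of_pos hr0]
          · simpa using hr0.le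
      _ = K * r := by simp
      _ ≤ (K + 1) * r := by gcongr; linarith
      _ = 1 / (n + 1) := by rw [hr]; field_simp
  have hn : (0 : ℝ) < n + 1 := by positivity
  calc ‖∑ i, wordTuple e r a i ∘L (wordTuple e r a i)†‖
      ≤ ∑ _i : Fin n, (1 / (n + 1) : ℝ) * (1 / (n + 1)) := by
        refine norm_sum_le_of_le _ fun i _ => (ContinuousLinearMap.opNorm_comp_le _ _).trans ?_
        rw [ContinuousLinearMap.adjoint.norm_map]
        exact mul_le_mul (hnorm i) (hnorm i) (norm_nonneg _) (by positivity)
    _ = n / (n + 1) * (1 / (n + 1)) := by simp; ring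
    _ < 1 := by
        rw [div_mul_div_comm, div_lt_one (by positivity)]
        nlinarith [Nat.cast_nonneg (α := ℝ) n]

theorem exists_orthonormal_nat (hG : ¬ FiniteDimensional ℂ G) :
    ∃ e : ℕ → G, Orthonormal ℂ e := by
  have : Infinite (Module.Basis.ofVectorSpaceIndex ℂ G) := by
    by_contra h
    rw [not_infinite_iff_finite] at h
    exact hG (Module.Basis.finiteDimensional_of_finite (Module.Basis.ofVectorSpace ℂ G))
  exact ⟨_, InnerProductSpace.gramSchmidtNormed_orthonormal
    ((Module.Basis.ofVectorSpace ℂ G).linearIndependent.comp _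
      (Infinite.natEmbedding _).injective)⟩

/-- The test tuple of the word `a` extracts the coefficient at `a` from a noncommutative
polynomial. -/
theorem inner_sum_opTensor_wordTuple {K : Type u} {L : Type v}
    [NormedAddCommGroup K] [InnerProductSpace ℂ K] [NormedAddCommGroup L] [InnerProductSpace ℂ L]
    {e : ℕ → G} (he : Orthonormal ℂ e) (r : ℝ) (a : FreeMonoid (Fin n))
    (C : FreeMonoid (Fin n) → K →L[ℂ] L) (N : ℕ) (x : K) (y : L) :
    ⟪tmulH (e 0) y, (∑ k ∈ Finset.range (N + 1), ∑ α ∈ words n k,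
        opTensor (evalWord (wordTuple e r a) α) (C α)) (tmulH (e a.length) x)⟫_ℂ
      = if a.length ≤ N then (r : ℂ) ^ a.length * ⟪y, C a x⟫_ℂ else 0 := by
  classical
  simp only [sum_apply, opTensor_tmulH, inner_sum, inner_tmulH, inner_evalWord_wordTuple_last he,
    ite_mul, zero_mul, Finset.sum_ite_eq', mem_words]
  simp [Finset.sum_ite_eq]

end WordTuple

/-! ### Polynomial characteristic functions through their coefficients -/

section Polynomial

variable {n : ℕ} {H : Type u} [NormedAddCommGroup H] [InnerProductSpace ℂ H] [CompleteSpace H]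

theorem charFun_wordTuple (T : RowBall n H) {G : Type w} [NormedAddCommGroup G]
    [InnerProductSpace ℂ G] [CompleteSpace G] {e : ℕ → G} (he : Orthonormal ℂ e) {r : ℝ}
    (a : FreeMonoid (Fin n)) (hr : InOpenBall (wordTuple e r a)) :
    charFun T (wordTuple e r a) = ∑ k ∈ Finset.range (a.length + 1), ∑ α ∈ words n k,
      opTensor (evalWord (wordTuple e r a) α) (charCoeff T α) :=
  charFun_eq_sum T hr _ fun α hα => by
    rw [evalWord_wordTuple_eq_zero he r hα, opTensor_zero_left]

theorem charFun_eq_sum_of_charCoeff_eq_zero (T : RowBall n H) {N : ℕ}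
    (hN : ∀ α : FreeMonoid (Fin n), N < α.length → charCoeff T α = 0) {G : Type w}
    [NormedAddCommGroup G] [InnerProductSpace ℂ G] [CompleteSpace G] {X : Fin n → G →L[ℂ] G}
    (hX : InOpenBall X) :
    charFun T X = ∑ k ∈ Finset.range (N + 1), ∑ α ∈ words n k,
      opTensor (evalWord X α) (charCoeff T α) :=
  charFun_eq_sum T hX N fun α hα => by rw [hN α hα, opTensor_zero_right]

/-- Uniqueness of coefficients turns the degree bound into vanishing of the higher coefficients. -/
theorem hasCharDegreeLE_iff (T : RowBall n H) (m : ℕ) :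
    HasCharDegreeLE T m ↔ ∀ α : FreeMonoid (Fin n), m < α.length → charCoeff T α = 0 := by
  refine ⟨?_, fun h => ⟨charCoeff T, fun G _ _ _ X hX =>
    charFun_eq_sum_of_charCoeff_eq_zero T h hX⟩⟩
  rintro ⟨A, hA⟩ a ha
  have he := (HilbertBasis.ofRepr
    (LinearIsometryEquiv.refl ℂ (lp (fun _ : ℕ => ℂ) 2))).orthonormal
  obtain ⟨r, hr0, hr⟩ := exists_wordTuple_inOpenBall he a
  have h := (charFun_wordTuple T he a hr).symm.trans (hA _ _ hr)
  ext1 x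
  refine ext_inner_left ℂ fun y => ?_
  have h1 := inner_sum_opTensor_wordTuple he r a (charCoeff T) a.length x y
  rw [h, inner_sum_opTensor_wordTuple he, if_neg (not_le.mpr ha), if_pos le_rfl] at h1
  have hrK : (r : ℂ) ^ a.length ≠ 0 := pow_ne_zero _ (by exact_mod_cast hr0.ne')
  simpa [hrK] using h1.symm

variable {H' : Type v} [NormedAddCommGroup H'] [InnerProductSpace ℂ H'] [CompleteSpace H']

theorem comp_sum_opTensor {G : Type w} [NormedAddCommGroup G] [InnerProductSpace ℂ G]
    {K : Type u} {L : Type v} {M : Type x}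
    [NormedAddCommGroup K] [InnerProductSpace ℂ K] [NormedAddCommGroup L] [InnerProductSpace ℂ L]
    [NormedAddCommGroup M] [InnerProductSpace ℂ M] (X : Fin n → G →L[ℂ] G) (B : L →L[ℂ] M)
    (C : FreeMonoid (Fin n) → K →L[ℂ] L) (N : ℕ) :
    opTensor 1 B ∘L ∑ k ∈ Finset.range N, ∑ α ∈ words n k, opTensor (evalWord X α) (C α)
      = ∑ k ∈ Finset.range N, ∑ α ∈ words n k, opTensor (evalWord X α) (B ∘L C α) := by
  simp only [ContinuousLinearMap.comp_finsetSum, opTensor_comp]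
  rfl

theorem sum_opTensor_comp {G : Type w} [NormedAddCommGroup G] [InnerProductSpace ℂ G]
    {K : Type u} {L : Type v} {M : Type x}
    [NormedAddCommGroup K] [InnerProductSpace ℂ K] [NormedAddCommGroup L] [InnerProductSpace ℂ L]
    [NormedAddCommGroup M] [InnerProductSpace ℂ M] (X : Fin n → G →L[ℂ] G)
    (C : FreeMonoid (Fin n) → L →L[ℂ] M) (B : K →L[ℂ] L) (N : ℕ) :
    (∑ k ∈ Finset.range N, ∑ α ∈ words n k, opTensor (evalWord X α) (C α)) ∘L opTensor 1 B
      = ∑ k ∈ Finset.range N, ∑ α ∈ words n k, opTensor (evalWord X α) (C α ∘L B) := by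
  simp only [ContinuousLinearMap.finsetSum_comp, opTensor_comp]
  rfl

/-- Intertwining of two characteristic functions on a ball over an infinite-dimensional space is
intertwining of their coefficients. -/
theorem charCoeff_comp_of_charFun_comp {G : Type w} [NormedAddCommGroup G]
    [InnerProductSpace ℂ G] [CompleteSpace G] (hG : ¬ FiniteDimensional ℂ G)
    {T : RowBall n H} {T' : RowBall n H'} {τ₁ : defectAdjSpace T.1 →L[ℂ] defectAdjSpace T'.1}
    {τ₂ : defectSpace T.1 →L[ℂ] defectSpace T'.1}
    (h : ∀ X : Fin n → G →L[ℂ] G, InOpenBall X →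
      charFun T' X ∘L opTensor 1 τ₁ = opTensor 1 τ₂ ∘L charFun T X) (a : FreeMonoid (Fin n)) :
    charCoeff T' a ∘L τ₁ = τ₂ ∘L charCoeff T a := by
  obtain ⟨e, he⟩ := exists_orthonormal_nat hG
  obtain ⟨r, hr0, hr⟩ := exists_wordTuple_inOpenBall he a
  have h1 := h _ hr
  rw [charFun_wordTuple T he a hr, charFun_wordTuple T' he a hr, comp_sum_opTensor,
    sum_opTensor_comp] at h1
  ext1 x
  refine ext_inner_left ℂ fun y => ?_
  have h2 := inner_sum_opTensor_wordTuple he r a (fun α => τ₂ ∘L charCoeff T α) a.length x y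
  rw [← h1, inner_sum_opTensor_wordTuple he, if_pos le_rfl, if_pos le_rfl] at h2
  exact mul_left_cancel₀ (pow_ne_zero _ (by exact_mod_cast hr0.ne')) h2

theorem charFun_comp_of_charCoeff_comp {G : Type w} [NormedAddCommGroup G]
    [InnerProductSpace ℂ G] [CompleteSpace G] {T : RowBall n H} {T' : RowBall n H'} {N : ℕ}
    (hT : ∀ α : FreeMonoid (Fin n), N < α.length → charCoeff T α = 0)
    (hT' : ∀ α : FreeMonoid (Fin n), N < α.length → charCoeff T' α = 0)
    {τ₁ : defectAdjSpace T.1 →L[ℂ] defectAdjSpace T'.1}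
    {τ₂ : defectSpace T.1 →L[ℂ] defectSpace T'.1}
    (h : ∀ α, charCoeff T' α ∘L τ₁ = τ₂ ∘L charCoeff T α) {X : Fin n → G →L[ℂ] G}
    (hX : InOpenBall X) : charFun T' X ∘L opTensor 1 τ₁ = opTensor 1 τ₂ ∘L charFun T X := by
  rw [charFun_eq_sum_of_charCoeff_eq_zero T hT hX, charFun_eq_sum_of_charCoeff_eq_zero T' hT' hX,
    comp_sum_opTensor, sum_opTensor_comp]
  simp only [h]

theorem hasPolynomialCharFun_iff (T : RowBall n H) :
    HasPolynomialCharFun T ↔ charDegree T ≠ ⊤ := by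
  rw [charDegree, ne_eq, iInf_eq_top]
  simp [HasPolynomialCharFun, iInf_eq_top]

theorem hasCharDegreeLE_toNat {T : RowBall n H} (h : charDegree T ≠ ⊤) :
    HasCharDegreeLE T (charDegree T).toNat := by
  classical
  have hex : ∃ m, HasCharDegreeLE T m := (hasPolynomialCharFun_iff T).mpr h
  have hle : charDegree T ≤ (Nat.find hex : ℕ∞) := iInf₂_le _ (Nat.find_spec hex)
  have hge : (Nat.find hex : ℕ∞) ≤ charDegree T :=
    le_iInf₂ fun m hm => by exact_mod_cast Nat.find_min' hex hm
  rw [le_antisymm hle hge, ENat.toNat_natCast]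
  exact Nat.find_spec hex

end Polynomial

/-! ### Defect operators and level sums -/

section Defect

variable {n : ℕ} {H : Type u} [NormedAddCommGroup H] [InnerProductSpace ℂ H] [CompleteSpace H]

theorem norm_sq_adjoint_rowOp (T : Fin n → H →L[ℂ] H) (h : H) :
    ‖((rowOp T)†) h‖ ^ 2 = ∑ i, ‖((T i)†) h‖ ^ 2 := by
  rw [PiLp.norm_sq_eq_of_L2]
  simp [adjoint_rowOp_apply]

theorem isRowContraction_iff (T : Fin n → H →L[ℂ] H) :
    IsRowContraction T ↔ ∀ h, ∑ i, ‖((T i)†) h‖ ^ 2 ≤ ‖h‖ ^ 2 := by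
  refine ⟨fun hT h => ?_, fun h => ?_⟩
  · have := norm_sq_defect hT h
    nlinarith [sq_nonneg ‖defect T h‖]
  · rw [IsRowContraction, ← sub_nonneg, ContinuousLinearMap.nonneg_iff_isPositive,
      ContinuousLinearMap.isPositive_def', ← rowOp_comp_adjoint]
    refine ⟨(IsSelfAdjoint.one _).sub
      (ContinuousLinearMap.isPositive_self_comp_adjoint _).isSelfAdjoint, fun x => ?_⟩
    have h1 := h x
    rw [← norm_sq_adjoint_rowOp] at h1
    rw [ContinuousLinearMap.reApplyInnerSelf_apply]
    simp only [sub_apply, one_apply_eq_self, inner_sub_left, ContinuousLinearMap.comp_apply,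
      map_sub, inner_self_eq_norm_sq]
    rw [← ContinuousLinearMap.adjoint_inner_right, inner_self_eq_norm_sq]
    linarith

theorem adjoint_defect (T : Fin n → H →L[ℂ] H) : (defect T)† = defect T :=
  (IsSelfAdjoint.of_nonneg (CFC.sqrt_nonneg _)).star_eq

theorem inner_defect (T : Fin n → H →L[ℂ] H) (x y : H) :
    ⟪defect T x, y⟫_ℂ = ⟪x, defect T y⟫_ℂ := by
  rw [← ContinuousLinearMap.adjoint_inner_right, adjoint_defect]

theorem defect_defect {T : Fin n → H →L[ℂ] H} (hT : IsRowContraction T) (h : H) :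
    defect T (defect T h) = h - ∑ i, T i (((T i)†) h) := by
  have hsq : defect T ∘L defect T = 1 - ∑ i, T i ∘L (T i)† :=
    CFC.sqrt_mul_sqrt_self _ (sub_nonneg.mpr hT)
  have := congrArg (fun B : H →L[ℂ] H => B h) hsq
  simpa [sum_apply] using this

/-- The quantity `∑_{|γ| = k} ‖T_γ* h‖²`. -/
def levelSum (T : Fin n → H →L[ℂ] H) (k : ℕ) (h : H) : ℝ :=
  ∑ γ ∈ words n k, ‖((evalWord T γ)†) h‖ ^ 2

theorem levelSum_nonneg (T : Fin n → H →L[ℂ] H) (k : ℕ) (h : H) : 0 ≤ levelSum T k h :=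
  Finset.sum_nonneg fun _ _ => sq_nonneg _

theorem levelSum_zero (T : Fin n → H →L[ℂ] H) (h : H) : levelSum T 0 h = ‖h‖ ^ 2 := by
  simp [levelSum, words_zero, adjoint_one]

theorem levelSum_succ {T : Fin n → H →L[ℂ] H} (hT : IsRowContraction T) (k : ℕ) (h : H) :
    levelSum T (k + 1) h
      = levelSum T k h - ∑ α ∈ words n k, ‖defect T (((evalWord T α)†) h)‖ ^ 2 := by
  rw [sum_words_defect hT]; simp [levelSum]

theorem levelSum_antitone {T : Fin n → H →L[ℂ] H} (hT : IsRowContraction T) (h : H) :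
    Antitone fun k => levelSum T k h :=
  antitone_nat_of_succ_le fun k => by
    rw [levelSum_succ hT]
    exact sub_le_self _ (Finset.sum_nonneg fun _ _ => sq_nonneg _)

theorem levelSum_le {T : Fin n → H →L[ℂ] H} (hT : IsRowContraction T) (k : ℕ) (h : H) :
    levelSum T k h ≤ ‖h‖ ^ 2 :=
  (levelSum_antitone hT h (Nat.zero_le k)).trans_eq (levelSum_zero T h)

theorem levelSum_add (T : Fin n → H →L[ℂ] H) (k m : ℕ) (h : H) :
    levelSum T (k + m) h = ∑ β ∈ words n k, levelSum T m (((evalWord T β)†) h) := by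
  rw [levelSum, sum_words_add]
  simp only [levelSum, adjoint_evalWord_mul_apply]

theorem levelSum_add_le (T : Fin n → H →L[ℂ] H) (k : ℕ) (x y : H) :
    levelSum T k (x + y) ≤ 2 * levelSum T k x + 2 * levelSum T k y := by
  rw [levelSum, levelSum, levelSum, Finset.mul_sum, Finset.mul_sum, ← Finset.sum_add_distrib]
  refine Finset.sum_le_sum fun α _ => ?_
  rw [map_add]
  have h1 := pow_le_pow_left₀ (norm_nonneg _)
    (norm_add_le (((evalWord T α)†) x) (((evalWord T α)†) y)) 2
  nlinarith [sq_nonneg (‖((evalWord T α)†) x‖ - ‖((evalWord T α)†) y‖)]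

/-- The level sums of `h` decrease from `‖h‖²` by the squared norms of the components of `K_T h`, so
`K_T h = 0` exactly when they do not decrease at all. -/
theorem forall_defect_eq_zero_iff {T : Fin n → H →L[ℂ] H} (hT : IsRowContraction T) (h : H) :
    (∀ α, defect T (((evalWord T α)†) h) = 0) ↔ ∀ k, levelSum T k h = ‖h‖ ^ 2 := by
  refine ⟨fun hd k => ?_, fun hl α => ?_⟩
  · induction k with
    | zero => exact levelSum_zero T h
    | succ k ih => rw [levelSum_succ hT, ih]; simp [hd]
  · have h1 := levelSum_succ hT α.length h
    rw [hl, hl] at h1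
    have h2 := (Finset.sum_eq_zero_iff_of_nonneg (fun _ _ => sq_nonneg _)).mp
      (sub_eq_self.mp h1.symm) α (mem_words.mpr rfl)
    simpa using h2

/-- Completely non-coisometric tuples: no nonzero `h` has `∑_{|γ| = k} ‖T_γ* h‖² = ‖h‖²` for all
`k`. For row contractions this is injectivity of the Poisson kernel. -/
def IsCNC (T : Fin n → H →L[ℂ] H) : Prop :=
  ∀ h : H, (∀ α, defect T (((evalWord T α)†) h) = 0) → h = 0

/-- The level sums of a vector in `ker K_T` are constant, so purity leaves only `0`. -/
theorem IsPure.isCNC {T : Fin n → H →L[ℂ] H} (hT : IsRowContraction T) (hp : IsPure T) :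
    IsCNC T := by
  intro h hd
  have h1 : Tendsto (fun _ : ℕ => ‖h‖ ^ 2) atTop (𝓝 0) :=
    (hp h).congr ((forall_defect_eq_zero_iff hT h).mp hd)
  have h2 : ‖h‖ ^ 2 = 0 := tendsto_nhds_unique tendsto_const_nhds h1
  simpa using h2

theorem mem_ker_poissonKernel_iff (T : RowBall n H) (h : H) :
    h ∈ LinearMap.ker (poissonKernel T).toLinearMap
      ↔ ∀ α, defect T.1 (((evalWord T.1 α)†) h) = 0 := by
  have happ : ∀ α, (poissonKernel T h α : H) = defect T.1 (((evalWord T.1 α)†) h) :=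
    fun _ => rfl
  rw [LinearMap.mem_ker]
  constructor
  · intro h0 α
    rw [← happ, show poissonKernel T h = 0 from h0]
    rfl
  · intro h0
    refine lp.ext (funext fun α => Subtype.ext ?_)
    exact h0 α

theorem ker_poissonKernel_eq_bot_iff (T : RowBall n H) :
    LinearMap.ker (poissonKernel T).toLinearMap = ⊥ ↔ IsCNC T.1 := by
  rw [Submodule.eq_bot_iff]
  exact forall_congr' fun h => by rw [mem_ker_poissonKernel_iff]

omit [CompleteSpace H] in
theorem dimension_eq_zero_iff (S : Submodule ℂ H) : dimension S = 0 ↔ S = ⊥ := by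
  rw [dimension, Cardinal.toENat_eq_zero, Submodule.rank_eq_zero]

theorem gamma_mem_pureGamma_iff (T : RowBall n H) :
    Gamma T ∈ pureGamma ↔ charDegree T ≠ ⊤ ∧ IsCNC T.1 := by
  rw [← ker_poissonKernel_eq_bot_iff, ← dimension_eq_zero_iff]
  simp only [Gamma, pureGamma, Set.mem_prod, Set.mem_univ, true_and, Set.mem_singleton_iff,
    Set.mem_range]
  refine and_congr_left' ⟨?_, fun h => ⟨_, ENat.natCast_toNat h⟩⟩
  rintro ⟨m, hm⟩
  rw [← hm]
  exact ENat.natCast_ne_top m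

end Defect

/-! ### The subspaces `𝒟_m` -/

section SpanSpace

variable {n : ℕ} {H : Type u} [NormedAddCommGroup H] [InnerProductSpace ℂ H] [CompleteSpace H]

theorem evalWord_defect_mem_spanSpace (T : Fin n → H →L[ℂ] H) {m : ℕ} {β : FreeMonoid (Fin n)}
    (hβ : m ≤ β.length) (h : H) : evalWord T β (defect T h) ∈ spanSpace T m :=
  Submodule.le_topologicalClosure _ (Submodule.subset_span ⟨β, h, hβ, rfl⟩)

theorem isClosed_spanSpace (T : Fin n → H →L[ℂ] H) (m : ℕ) :
    IsClosed (spanSpace T m : Set H) := Submodule.isClosed_topologicalClosure _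

theorem spanSpace_le {T : Fin n → H →L[ℂ] H} {m : ℕ} {S : Submodule ℂ H}
    (hS : IsClosed (S : Set H))
    (h : ∀ (β : FreeMonoid (Fin n)) (h : H), m ≤ β.length → evalWord T β (defect T h) ∈ S) :
    spanSpace T m ≤ S := by
  refine Submodule.topologicalClosure_minimal _ (Submodule.span_le.mpr ?_) hS
  rintro _ ⟨β, y, hβ, rfl⟩
  exact h β y hβ

theorem spanSpace_antitone (T : Fin n → H →L[ℂ] H) : Antitone (spanSpace T) := fun _ _ hmk =>
  spanSpace_le (isClosed_spanSpace T _) fun _ h hβ =>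
    evalWord_defect_mem_spanSpace T (hmk.trans hβ) h

theorem apply_mem_spanSpace_succ (T : Fin n → H →L[ℂ] H) (i : Fin n) {m : ℕ} {x : H}
    (hx : x ∈ spanSpace T m) : T i x ∈ spanSpace T (m + 1) := by
  have hle : spanSpace T m ≤ (spanSpace T (m + 1)).comap (T i).toLinearMap := by
    refine spanSpace_le ((isClosed_spanSpace T (m + 1)).preimage (T i).continuous) fun β h hβ => ?_
    have h1 : evalWord T (FreeMonoid.of i * β) (defect T h) ∈ spanSpace T (m + 1) :=
      evalWord_defect_mem_spanSpace T
        (by rw [FreeMonoid.length_mul, FreeMonoid.length_of]; omega) h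
    rwa [evalWord_mul_apply, evalWord_of] at h1
  exact hle hx

theorem evalWord_mem_spanSpace (T : Fin n → H →L[ℂ] H) (α : FreeMonoid (Fin n)) {x : H}
    (hx : x ∈ spanSpace T 0) : evalWord T α x ∈ spanSpace T α.length := by
  induction α using FreeMonoid.inductionOn' with
  | one => exact hx
  | of_mul i α ih =>
    rw [evalWord_mul_apply, evalWord_of, FreeMonoid.length_mul, FreeMonoid.length_of, add_comm]
    exact apply_mem_spanSpace_succ T i ih

theorem defect_eq_zero_of_forall_inner (T : Fin n → H →L[ℂ] H) {x : H}
    (h : ∀ y, ⟪defect T y, x⟫_ℂ = 0) : defect T x = 0 := by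
  have := h (defect T x)
  rwa [inner_defect, inner_self_eq_zero] at this

/-- The orthogonal complement of `𝒟_0` is `ker K_T`. -/
theorem spanSpace_zero_eq_top {T : Fin n → H →L[ℂ] H} (h : IsCNC T) : spanSpace T 0 = ⊤ := by
  rw [spanSpace, Submodule.topologicalClosure_eq_top_iff, Submodule.eq_bot_iff]
  intro x hx
  refine h x fun α => defect_eq_zero_of_forall_inner T fun y => ?_
  rw [ContinuousLinearMap.adjoint_inner_right]
  exact (Submodule.mem_orthogonal _ _).mp hx _
    (Submodule.subset_span ⟨α, y, Nat.zero_le _, rfl⟩)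

end SpanSpace

/-! ### Row isometries and the Wold decomposition -/

section Wold

variable {n : ℕ} {H : Type u} [NormedAddCommGroup H] [InnerProductSpace ℂ H] [CompleteSpace H]

/-- Row isometries are characterised by `Vᵢ* Vⱼ = δᵢⱼ I`. -/
theorem isRowIsometry_iff (V : Fin n → H →L[ℂ] H) :
    IsRowIsometry V ↔ ∀ i j x, ((V i)†) (V j x) = if i = j then x else 0 := by
  rw [IsRowIsometry, ContinuousLinearMap.norm_map_iff_adjoint_comp_self]
  constructor
  · intro h i j x
    have h1 := congrArg (fun B : Copies n H →L[ℂ] Copies n H =>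
      B (WithLp.toLp 2 (Pi.single j x : Fin n → H)) i) h
    simp only [ContinuousLinearMap.comp_apply, adjoint_rowOp_apply, rowOp_apply,
      one_apply_eq_self] at h1
    rw [Finset.sum_eq_single j (by simp +contextual) (by simp)] at h1
    simpa [Pi.single_apply] using h1
  · intro h
    ext x i
    simp [adjoint_rowOp_apply, rowOp_apply, h]

theorem IsRowIsometry.isRowContraction {V : Fin n → H →L[ℂ] H} (hV : IsRowIsometry V) :
    IsRowContraction V := by
  rw [isRowContraction_iff]
  intro h
  rw [← norm_sq_adjoint_rowOp]
  have h1 : ‖(rowOp V)†‖ ≤ 1 := by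
    rw [ContinuousLinearMap.adjoint.norm_map]
    exact ContinuousLinearMap.opNorm_le_bound _ zero_le_one fun x => by rw [hV x, one_mul]
  have h2 := ((rowOp V)†).le_of_opNorm_le h1 h
  rw [one_mul] at h2
  gcongr

theorem adjoint_apply_defect_of_isRowIsometry {V : Fin n → H →L[ℂ] H} (hV : IsRowIsometry V)
    (i : Fin n) (h : H) : ((V i)†) (defect V h) = 0 := by
  have h0 : ∀ x, defect V (V i x) = 0 := by
    intro x
    rw [← inner_self_eq_zero (𝕜 := ℂ), inner_defect, defect_defect hV.isRowContraction]
    simp only [(isRowIsometry_iff V).mp hV, apply_ite, map_zero]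
    simp
  refine ext_inner_right ℂ fun x => ?_
  rw [ContinuousLinearMap.adjoint_inner_left, inner_defect, h0, inner_zero_right, inner_zero_left]

theorem adjoint_evalWord_evalWord_defect {V : Fin n → H →L[ℂ] H} (hV : IsRowIsometry V)
    {γ β : FreeMonoid (Fin n)} (hl : β.length < γ.length) (h : H) :
    ((evalWord V γ)†) (evalWord V β (defect V h)) = 0 := by
  induction γ using FreeMonoid.inductionOn' generalizing β with
  | one => exact absurd hl (Nat.not_lt_zero _)
  | of_mul i γ ih =>
    rw [adjoint_evalWord_mul_apply, evalWord_of]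
    induction β using FreeMonoid.inductionOn' with
    | one =>
      rw [evalWord_one, one_apply_eq_self, adjoint_apply_defect_of_isRowIsometry hV, map_zero]
    | of_mul j β _ =>
      rw [evalWord_mul_apply, evalWord_of, (isRowIsometry_iff V).mp hV]
      rw [FreeMonoid.length_mul, FreeMonoid.length_mul, FreeMonoid.length_of,
        FreeMonoid.length_of] at hl
      split_ifs
      · exact ih (by omega)
      · exact map_zero _

/-- The closed subspace of the vectors `h` with `∑_{|γ| = k} ‖T_γ* h‖² → 0`. -/
def pureSpace (T : Fin n → H →L[ℂ] H) : Submodule ℂ H where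
  carrier := {h | Tendsto (fun k => levelSum T k h) atTop (𝓝 0)}
  zero_mem' := by simp [levelSum]
  add_mem' {x y} hx hy := by
    refine squeeze_zero (fun k => levelSum_nonneg T k _) (fun k => levelSum_add_le T k x y) ?_
    simpa using (hx.const_mul 2).add (hy.const_mul 2)
  smul_mem' c x hx := by
    have h1 : ∀ k, levelSum T k (c • x) = ‖c‖ ^ 2 * levelSum T k x := fun k => by
      simp [levelSum, norm_smul, mul_pow, Finset.mul_sum]
    simpa [h1] using Tendsto.const_mul (‖c‖ ^ 2) hx

theorem mem_pureSpace {T : Fin n → H →L[ℂ] H} {h : H} :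
    h ∈ pureSpace T ↔ Tendsto (fun k => levelSum T k h) atTop (𝓝 0) := Iff.rfl

theorem isPure_iff_pureSpace (T : Fin n → H →L[ℂ] H) : IsPure T ↔ pureSpace T = ⊤ :=
  (Submodule.eq_top_iff' (p := pureSpace T)).symm

theorem isClosed_pureSpace {T : Fin n → H →L[ℂ] H} (hT : IsRowContraction T) :
    IsClosed (pureSpace T : Set H) := by
  refine isClosed_of_closure_subset fun h hh => ?_
  change Tendsto (fun k => levelSum T k h) atTop (𝓝 0)
  rw [Metric.tendsto_atTop]
  intro ε hε
  obtain ⟨z, hz, hzd⟩ := Metric.mem_closure_iff.mp hh (√(ε / 4)) (by positivity)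
  obtain ⟨N, hN⟩ := Metric.tendsto_atTop.mp (mem_pureSpace.mp hz) (ε / 4) (by positivity)
  refine ⟨N, fun k hk => ?_⟩
  have h1 := hN k hk
  rw [Real.dist_0_eq_abs, abs_of_nonneg (levelSum_nonneg _ _ _)] at h1 ⊢
  have h2 := levelSum_add_le T k z (h - z)
  rw [add_sub_cancel] at h2
  have h3 := levelSum_le hT k (h - z)
  have h4 : ‖h - z‖ ^ 2 < ε / 4 := by
    rw [← dist_eq_norm]
    exact (Real.lt_sqrt dist_nonneg).mp hzd
  linarith

/-- The Wold decomposition for a row isometry without unitary part. Here `V_γ* V_β Δ_V = 0` as soon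
as `|γ| > |β|`, so the vectors `V_β Δ_V h`, which span the space, are pure. -/
theorem IsRowIsometry.isPure {V : Fin n → H →L[ℂ] H} (hV : IsRowIsometry V) (hc : IsCNC V) :
    IsPure V := by
  rw [isPure_iff_pureSpace, eq_top_iff, ← spanSpace_zero_eq_top hc]
  refine spanSpace_le (isClosed_pureSpace hV.isRowContraction) fun β h _ => ?_
  refine tendsto_const_nhds.congr' ?_
  filter_upwards [eventually_gt_atTop β.length] with k hk
  refine (Finset.sum_eq_zero fun γ hγ => ?_).symm
  rw [adjoint_evalWord_evalWord_defect hV (by rwa [mem_words.mp hγ]), norm_zero,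
    zero_pow two_ne_zero]

end Wold

/-! ### Compressions -/

section Compression

variable {n : ℕ} {H : Type u} [NormedAddCommGroup H] [InnerProductSpace ℂ H] [CompleteSpace H]
  {T : Fin n → H →L[ℂ] H} (S : Submodule ℂ H) [CompleteSpace S]

omit [CompleteSpace H] in
theorem compression_apply (A : H →L[ℂ] H) (x : S) :
    compression S A x = S.orthogonalProjectionOnto (A x) := rfl

theorem adjoint_compression (A : H →L[ℂ] H) : (compression S A)† = compression S (A†) := by
  rw [compression, ContinuousLinearMap.adjoint_comp, ContinuousLinearMap.adjoint_comp,
    Submodule.adjoint_subtypeL, Submodule.adjoint_orthogonalProjectionOnto]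
  rfl

omit [CompleteSpace H] in
theorem norm_compression_apply_le (A : H →L[ℂ] H) (x : S) : ‖compression S A x‖ ≤ ‖A x‖ :=
  S.norm_orthogonalProjectionOnto_apply_le _

theorem isRowContraction_compression (hT : IsRowContraction T) :
    IsRowContraction fun i => compression S (T i) := by
  rw [isRowContraction_iff] at hT ⊢
  intro x
  refine le_trans (Finset.sum_le_sum fun i _ => ?_) (hT x)
  rw [adjoint_compression]
  gcongr
  exact norm_compression_apply_le S _ x

omit [CompleteSpace H] in
theorem compression_apply_of_mem {A : H →L[ℂ] H} {x : S} (h : A x ∈ S) :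
    (compression S A x : H) = A x := by
  rw [compression_apply]
  exact congrArg Subtype.val (Submodule.orthogonalProjectionOnto_mem_subspace_eq_self (⟨_, h⟩ : S))

variable {S}

omit [CompleteSpace H] [CompleteSpace S] in
theorem evalWord_mem_of_invariant (hS : ∀ i, ∀ x ∈ S, T i x ∈ S) (α : FreeMonoid (Fin n)) {x : H}
    (hx : x ∈ S) : evalWord T α x ∈ S := by
  induction α using FreeMonoid.inductionOn' with
  | one => exact hx
  | of_mul i α ih => rw [evalWord_mul_apply, evalWord_of]; exact hS i _ ih

omit [CompleteSpace H] in
theorem evalWord_compression (hS : ∀ i, ∀ x ∈ S, T i x ∈ S) (α : FreeMonoid (Fin n)) :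
    evalWord (fun i => compression S (T i)) α = compression S (evalWord T α) := by
  ext x
  rw [compression_apply_of_mem S (evalWord_mem_of_invariant hS α x.2)]
  induction α using FreeMonoid.inductionOn' with
  | one => simp
  | of_mul i α ih =>
    rw [evalWord_mul_apply, evalWord_mul_apply, evalWord_of, evalWord_of,
      compression_apply_of_mem S (hS i _ (SetLike.coe_mem _)), ih]

omit [CompleteSpace H] in
/-- Compressing to the orthogonal complement of an invariant subspace is multiplicative. -/
theorem evalWord_compression_orthogonal (hS : ∀ i, ∀ x ∈ S, T i x ∈ S) {S' : Submodule ℂ H}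
    [CompleteSpace S'] (hS' : S' = Sᗮ) (α : FreeMonoid (Fin n)) (x : S') :
    evalWord (fun i => compression S' (T i)) α x
      = S'.orthogonalProjectionOnto (evalWord T α x) := by
  have hS'' : S'ᗮ = S := by rw [hS', Submodule.orthogonal_orthogonal]
  induction α using FreeMonoid.inductionOn' with
  | one => simp
  | of_mul i α ih =>
    rw [evalWord_mul_apply, evalWord_mul_apply, evalWord_of, evalWord_of, ih, compression_apply,
      ← sub_eq_zero, ← map_sub, ← map_sub]
    set z := evalWord T α x
    have hz : (S'.orthogonalProjectionOnto z : H) - z ∈ S := by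
      have h1 : z - S'.starProjection z ∈ S'ᗮ := Submodule.sub_starProjection_mem_orthogonal z
      rw [hS''] at h1
      have h2 := S.neg_mem h1
      rwa [neg_sub] at h2
    rw [Submodule.orthogonalProjectionOnto_eq_zero_iff, hS'']
    exact hS i _ hz

theorem isRowIsometry_compression (hS : ∀ i, ∀ x ∈ S, T i x ∈ S)
    (hiso : ∀ i j, ∀ x ∈ S, ((T i)†) (T j x) = if i = j then x else 0) :
    IsRowIsometry fun i => compression S (T i) := by
  rw [isRowIsometry_iff]
  intro i j x
  ext
  rw [adjoint_compression, compression_apply, compression_apply_of_mem S (hS j x x.2),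
    hiso i j x x.2]
  split_ifs
  · exact congrArg _ (Submodule.orthogonalProjectionOnto_mem_subspace_eq_self x)
  · simp

theorem levelSum_compression (hS : ∀ i, ∀ x ∈ S, T i x ∈ S) (k : ℕ) (x : S) :
    levelSum (fun i => compression S (T i)) k x
      = ∑ β ∈ words n k, ‖S.orthogonalProjectionOnto (((evalWord T β)†) x)‖ ^ 2 := by
  refine Finset.sum_congr rfl fun β _ => ?_
  rw [evalWord_compression hS, adjoint_compression, compression_apply]

/-- Level sums of a compression to an invariant subspace are at most those of `T`, so a vector on
which they stay maximal for the compression is one for `T`. -/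
theorem isCNC_compression (hT : IsRowContraction T) (hc : IsCNC T)
    (hS : ∀ i, ∀ x ∈ S, T i x ∈ S) : IsCNC fun i => compression S (T i) := by
  intro x hx
  rw [forall_defect_eq_zero_iff (isRowContraction_compression S hT)] at hx
  refine Subtype.ext (hc x ?_)
  rw [forall_defect_eq_zero_iff hT]
  refine fun k => le_antisymm (levelSum_le hT k x) ?_
  refine (hx k).symm.le.trans ?_
  rw [levelSum_compression hS]
  exact Finset.sum_le_sum fun β _ =>
    pow_le_pow_left₀ (norm_nonneg _) (S.norm_orthogonalProjectionOnto_apply_le _) 2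

/-- If `T` is pure on the invariant subspace `S` and all `T_α` with `|α| = m` map into `S`, then
`T` is pure. -/
theorem isPure_of_compression (hT : IsRowContraction T) (hS : ∀ i, ∀ x ∈ S, T i x ∈ S)
    (hp : IsPure fun i => compression S (T i)) {m : ℕ}
    (hm : ∀ α : FreeMonoid (Fin n), α.length = m → ∀ x, evalWord T α x ∈ S) : IsPure T := by
  -- `T_γ*` annihilates `Sᗮ` for `|γ| = m`, so the last `m` letters only see the projection to `S`
  have hker : ∀ γ : FreeMonoid (Fin n), γ.length = m → ∀ z ∈ Sᗮ, ((evalWord T γ)†) z = 0 := by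
    intro γ hγ z hz
    refine ext_inner_right ℂ fun y => ?_
    rw [ContinuousLinearMap.adjoint_inner_left, inner_zero_left]
    exact (Submodule.mem_orthogonal' _ _).mp hz _ (hm γ hγ y)
  have hproj : ∀ z, levelSum T m z ≤ ‖S.orthogonalProjectionOnto z‖ ^ 2 := by
    intro z
    have h1 : levelSum T m z = levelSum T m (S.orthogonalProjectionOnto z : H) := by
      refine Finset.sum_congr rfl fun γ hγ => ?_
      have h2 := hker γ (mem_words.mp hγ) _ (Submodule.sub_starProjection_mem_orthogonal (K := S) z)
      rw [map_sub, sub_eq_zero] at h2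
      rw [h2]
      rfl
    rw [h1]
    exact levelSum_le hT m _
  rw [isPure_iff_pureSpace, Submodule.eq_top_iff']
  intro h
  rw [← add_sub_cancel (S.orthogonalProjectionOnto h : H) h]
  refine Submodule.add_mem _ ?_ ?_
  · rw [mem_pureSpace, ← tendsto_add_atTop_iff_nat m]
    refine squeeze_zero (fun k => levelSum_nonneg T _ _) (fun k => ?_)
      (hp (S.orthogonalProjectionOnto h))
    rw [levelSum_add]
    refine (Finset.sum_le_sum fun β _ => hproj _).trans_eq ?_
    exact (levelSum_compression hS k _).symm
  · rw [mem_pureSpace, ← tendsto_add_atTop_iff_nat m]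
    refine tendsto_const_nhds.congr fun k => ?_
    rw [add_comm, levelSum_add]
    refine (Finset.sum_eq_zero fun β hβ => ?_).symm
    rw [hker β (mem_words.mp hβ) (h - S.orthogonalProjectionOnto h)
      (Submodule.sub_starProjection_mem_orthogonal h)]
    simp [levelSum]

end Compression

/-! ### The canonical form -/

section CanonicalForm

variable {n : ℕ} {H : Type u} [NormedAddCommGroup H] [InnerProductSpace ℂ H] [CompleteSpace H]

omit [CompleteSpace H] in
theorem inner_single_right (i : Fin n) (u : H) (z : Copies n H) :
    ⟪z, (WithLp.toLp 2 (Pi.single i u : Fin n → H) : Copies n H)⟫_ℂ = ⟪z i, u⟫_ℂ := by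
  rw [PiLp.inner_apply, Finset.sum_eq_single i] <;> simp +contextual

theorem rowOp_single (T : Fin n → H →L[ℂ] H) (i : Fin n) (u : H) :
    rowOp T (WithLp.toLp 2 (Pi.single i u : Fin n → H)) = T i u := by
  rw [rowOp_apply, Finset.sum_eq_single i] <;> simp +contextual

theorem inner_defectAdj (T : Fin n → H →L[ℂ] H) (x y : Copies n H) :
    ⟪defectAdj T x, y⟫_ℂ = ⟪x, defectAdj T y⟫_ℂ := by
  rw [← ContinuousLinearMap.adjoint_inner_right, defectAdj, adjoint_sqrtOneSub]

theorem defectAdj_mem (T : Fin n → H →L[ℂ] H) (x : Copies n H) :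
    defectAdj T x ∈ defectAdjSpace T :=
  Submodule.le_topologicalClosure _ (LinearMap.mem_range_self _ x)

theorem defectAdj_defectAdj {T : Fin n → H →L[ℂ] H} (hT : IsRowContraction T)
    (x : Copies n H) : defectAdj T (defectAdj T x) = x - ((rowOp T)†) (rowOp T x) := by
  have := congrArg (fun B : Copies n H →L[ℂ] Copies n H => B x)
    (sqrtOneSub_sq (norm_rowOp_le hT))
  exact this

/-- If the coefficient `Δ_T T_β* P_j Δ_{T*}` of `Θ_T` vanishes, then `I - T*T = Δ_{T*}²` vanishes
on the vectors `T_β Δ_T h` placed at position `j`. -/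
theorem adjoint_apply_evalWord_defect (T : RowBall n H) {β : FreeMonoid (Fin n)} {j : Fin n}
    (h0 : revCoeff T (FreeMonoid.of j * β) = 0) (i : Fin n) (h : H) :
    ((T.1 i)†) (T.1 j (evalWord T.1 β (defect T.1 h)))
      = if i = j then evalWord T.1 β (defect T.1 h) else 0 := by
  set u := evalWord T.1 β (defect T.1 h) with hu
  have h1 : defectAdj T.1 (defectAdj T.1 (WithLp.toLp 2 (Pi.single j u : Fin n → H))) = 0 := by
    refine ext_inner_left ℂ fun y => ?_
    have h2 : defect T.1 (((evalWord T.1 β)†) (defectAdj T.1 (defectAdj T.1 y) j)) = 0 := by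
      have := congrArg (fun B : defectAdjSpace T.1 →L[ℂ] defectSpace T.1 =>
        (B ⟨defectAdj T.1 y, defectAdj_mem T.1 y⟩ : H)) h0
      exact this
    rw [← inner_defectAdj, ← inner_defectAdj, inner_single_right, hu,
      ← ContinuousLinearMap.adjoint_inner_left, ← inner_defect, h2, inner_zero_left,
      inner_zero_right]
  rw [defectAdj_defectAdj T.2, sub_eq_zero, rowOp_single] at h1
  have h3 := congrArg (fun z : Copies n H => z i) h1
  simp only [adjoint_rowOp_apply] at h3
  rw [← h3]
  simp [Pi.single_apply]

/-- If `deg Θ_T ≤ m`, then `T` is a row isometry on `𝒟_m`. -/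
theorem adjoint_apply_of_mem_spanSpace (T : RowBall n H) {m : ℕ} (hm : HasCharDegreeLE T m)
    (i j : Fin n) {x : H} (hx : x ∈ spanSpace T.1 m) :
    ((T.1 i)†) (T.1 j x) = if i = j then x else 0 := by
  rw [hasCharDegreeLE_iff] at hm
  have hle : spanSpace T.1 m ≤ LinearMap.ker
      (((T.1 i)† ∘L T.1 j - if i = j then ContinuousLinearMap.id ℂ H else 0 :
        H →L[ℂ] H)).toLinearMap := by
    refine spanSpace_le (ContinuousLinearMap.isClosed_ker _) fun β h hβ => ?_
    have h0 : revCoeff T (FreeMonoid.of j * β) = 0 := by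
      have := hm (FreeMonoid.of j * β).reverse (by
        rw [FreeMonoid.length_reverse, FreeMonoid.length_mul, FreeMonoid.length_of]; omega)
      rwa [charCoeff, FreeMonoid.reverse_reverse] at this
    have h1 := adjoint_apply_evalWord_defect T h0 i h
    rw [LinearMap.mem_ker]
    refine sub_eq_zero.mpr (h1.trans ?_)
    split_ifs <;> rfl
  have h2 := sub_eq_zero.mp (LinearMap.mem_ker.mp (hle hx))
  refine h2.trans ?_
  split_ifs <;> rfl

theorem apply_mem_spaceV (T : RowBall n H) (i : Fin n) (x : H) (hx : x ∈ spaceV T) :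
    T.1 i x ∈ spaceV T :=
  spanSpace_antitone T.1 (Nat.le_succ _) (apply_mem_spanSpace_succ T.1 i hx)

theorem isRowIsometry_compression_spaceV {T : RowBall n H} (hd : charDegree T ≠ ⊤) :
    IsRowIsometry fun i => compression (spaceV T) (T.1 i) :=
  isRowIsometry_compression (apply_mem_spaceV T) fun i j _ hx =>
    adjoint_apply_of_mem_spanSpace T (hasCharDegreeLE_toNat hd) i j hx

theorem isPure_compression_spaceV {T : RowBall n H} (hd : charDegree T ≠ ⊤) (hc : IsCNC T.1) :
    IsPure fun i => compression (spaceV T) (T.1 i) :=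
  (isRowIsometry_compression_spaceV hd).isPure (isCNC_compression T.2 hc (apply_mem_spaceV T))

theorem evalWord_mem_spaceV {T : RowBall n H} (hc : IsCNC T.1) {α : FreeMonoid (Fin n)}
    (hα : α.length = (charDegree T).toNat) (x : H) : evalWord T.1 α x ∈ spaceV T := by
  have h := evalWord_mem_spanSpace T.1 α (x := x)
    (by rw [spanSpace_zero_eq_top hc]; exact Submodule.mem_top)
  rwa [hα] at h

theorem isPure_of_isCNC {T : RowBall n H} (hd : charDegree T ≠ ⊤) (hc : IsCNC T.1) :
    IsPure T.1 :=
  isPure_of_compression (S := spaceV T) T.2 (apply_mem_spaceV T) (isPure_compression_spaceV hd hc)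
    fun _ hα x => evalWord_mem_spaceV hc hα x

theorem isPure_and_hasPolynomialCharFun_iff (T : RowBall n H) :
    IsPure T.1 ∧ HasPolynomialCharFun T ↔ Gamma T ∈ pureGamma := by
  rw [gamma_mem_pureGamma_iff, hasPolynomialCharFun_iff]
  exact ⟨fun h => ⟨h.2, h.1.isCNC T.2⟩, fun h => ⟨isPure_of_isCNC h.1 h.2, h.1⟩⟩

theorem spaceNil_eq_orthogonal {T : RowBall n H} (hc : IsCNC T.1) : spaceNil T = (spaceV T)ᗮ := by
  rw [spaceNil, spanSpace_zero_eq_top hc, top_inf_eq]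

theorem hasCanonicalVNForm {T : RowBall n H} (hd : charDegree T ≠ ⊤) (hc : IsCNC T.1) :
    HasCanonicalVNForm T := by
  have hnil := spaceNil_eq_orthogonal hc
  have horth : (spaceNil T)ᗮ = spaceV T := by rw [hnil, Submodule.orthogonal_orthogonal]
  have hzero : ∀ α : FreeMonoid (Fin n), α.length = (charDegree T).toNat →
      evalWord (fun i => compression (spaceNil T) (T.1 i)) α = 0 := by
    intro α hα
    ext1 x
    rw [evalWord_compression_orthogonal (apply_mem_spaceV T) hnil]
    refine Submodule.orthogonalProjectionOnto_eq_zero_iff.mpr ?_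
    rw [horth]
    exact evalWord_mem_spaceV hc hα x
  refine ⟨?_, ?_, ?_, isRowContraction_compression _ T.2, isRowIsometry_compression_spaceV hd,
    isPure_compression_spaceV hd hc, isRowContraction_compression _ T.2, ⟨_, hzero⟩, ?_⟩
  · rw [hnil]
    exact Submodule.isOrtho_orthogonal_right _
  · rw [hnil]
    exact Submodule.sup_orthogonal_of_hasOrthogonalProjection
  · intro i x hx
    refine Submodule.orthogonalProjectionOnto_eq_zero_iff.mpr ?_
    rw [horth]
    exact apply_mem_spaceV T i x hx
  · have hle : (nilpotentOrder fun i => compression (spaceNil T) (T.1 i))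
        ≤ (charDegree T).toNat := Nat.sInf_le hzero
    rw [← ENat.natCast_toNat hd]
    exact_mod_cast hle

end CanonicalForm

/-! ### Intertwining of the two defect operators -/

section Intertwining

theorem commute_sqrt_of_commute {E : Type v} [NormedAddCommGroup E] [InnerProductSpace ℂ E]
    [CompleteSpace E] {a b : E →L[ℂ] E} (h : Commute a b) : Commute (CFC.sqrt a) b :=
  h.cfcₙ_nnreal _

/-- `A (I - A*A)^{1/2} = (I - AA*)^{1/2} A` for a contraction `A`. With `S` and `R` the two square
roots, uniqueness of positive square roots gives `A* R A = A* A S`, and then all four terms in the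
expansion of `‖A S x - R A x‖²` agree. -/
theorem comp_sqrtOneSub {E : Type v} {F : Type w} [NormedAddCommGroup E] [InnerProductSpace ℂ E]
    [CompleteSpace E] [NormedAddCommGroup F] [InnerProductSpace ℂ F] [CompleteSpace F]
    {A : E →L[ℂ] F} (hA : ‖A‖ ≤ 1) (x : E) : A (sqrtOneSub A x) = sqrtOneSub (A†) (A x) := by
  have hA' : ‖A†‖ ≤ 1 := by rwa [ContinuousLinearMap.adjoint.norm_map]
  set S := sqrtOneSub A with hS
  set R := sqrtOneSub (A†) with hR
  have hSS : ∀ y, S (S y) = y - (A†) (A y) := fun y =>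
    congrArg (fun B : E →L[ℂ] E => B y) (sqrtOneSub_sq hA)
  have hRR : ∀ y, R (R y) = y - A ((A†) y) := fun y => by
    have := congrArg (fun B : F →L[ℂ] F => B y) (sqrtOneSub_sq hA')
    rw [ContinuousLinearMap.adjoint_adjoint] at this
    exact this
  have hSi : ∀ y z, ⟪S y, z⟫_ℂ = ⟪y, S z⟫_ℂ := fun y z => by
    rw [← ContinuousLinearMap.adjoint_inner_right, hS, adjoint_sqrtOneSub]
  have hRi : ∀ y z, ⟪R y, z⟫_ℂ = ⟪y, R z⟫_ℂ := fun y z => by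
    rw [← ContinuousLinearMap.adjoint_inner_right, hR, adjoint_sqrtOneSub]
  have hSc : Commute S (A† ∘L A) :=
    commute_sqrt_of_commute ((Commute.one_left _).sub_left (Commute.refl _))
  have hRc : Commute R (A ∘L A†) :=
    commute_sqrt_of_commute ((Commute.one_left _).sub_left (by
      rw [ContinuousLinearMap.adjoint_adjoint]; exact Commute.refl _))
  have hSN : ∀ y, S ((A†) (A y)) = (A†) (A (S y)) := fun y =>
    congrArg (fun B : E →L[ℂ] E => B y) hSc.eq
  have hRM : ∀ y, R (A ((A†) y)) = A ((A†) (R y)) := fun y =>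
    congrArg (fun B : F →L[ℂ] F => B y) hRc.eq
  -- `A* R A` and `A* A S` are positive operators with the same square
  have hp0 : 0 ≤ A† ∘L R ∘L A := by
    rw [ContinuousLinearMap.nonneg_iff_isPositive]
    exact ((ContinuousLinearMap.nonneg_iff_isPositive _).mp
      (CFC.sqrt_nonneg _ : 0 ≤ R)).adjoint_conj A
  have hq0 : 0 ≤ (A† ∘L A) * S := by
    refine Commute.mul_nonneg ?_ (CFC.sqrt_nonneg _) hSc.symm
    rw [ContinuousLinearMap.nonneg_iff_isPositive]
    exact ContinuousLinearMap.isPositive_adjoint_comp_self A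
  have hpq : A† ∘L R ∘L A = (A† ∘L A) * S := by
    rw [← CFC.mul_self_eq_mul_self_iff _ _ hp0 hq0]
    ext y
    change (A†) (R (A ((A†) (R (A y))))) = (A†) (A (S ((A†) (A (S y)))))
    rw [hRM, hRR, hSN, hSS]
    simp only [map_sub]
  have hq : ∀ y, (A†) (R (A y)) = (A†) (A (S y)) := fun y =>
    congrArg (fun B : E →L[ℂ] E => B y) hpq
  have e1 : ⟪A (S x), A (S x)⟫_ℂ = ⟪S x, (A†) (A (S x))⟫_ℂ :=
    (ContinuousLinearMap.adjoint_inner_right _ _ _).symm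
  have e2 : ⟪A (S x), R (A x)⟫_ℂ = ⟪S x, (A†) (A (S x))⟫_ℂ := by
    rw [← hq, ContinuousLinearMap.adjoint_inner_right]
  have e3 : ⟪R (A x), A (S x)⟫_ℂ = ⟪S x, (A†) (A (S x))⟫_ℂ := by
    rw [← ContinuousLinearMap.adjoint_inner_left, hq, ContinuousLinearMap.adjoint_inner_left,
      ContinuousLinearMap.adjoint_inner_right]
  have e4 : ⟪R (A x), R (A x)⟫_ℂ = ⟪S x, (A†) (A (S x))⟫_ℂ := by
    rw [← hRi, hRR, ← map_sub, ← hSS, ← ContinuousLinearMap.adjoint_inner_right, hSi, hSN]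
  rw [← sub_eq_zero, ← inner_self_eq_zero (𝕜 := ℂ), inner_sub_left, inner_sub_right,
    inner_sub_right, e1, e2, e3, e4, sub_self]

variable {n : ℕ} {H : Type u} [NormedAddCommGroup H] [InnerProductSpace ℂ H] [CompleteSpace H]

theorem rowOp_defectAdj {T : Fin n → H →L[ℂ] H} (hT : IsRowContraction T) (x : Copies n H) :
    rowOp T (defectAdj T x) = defect T (rowOp T x) := by
  have hR : sqrtOneSub ((rowOp T)†) = defect T := by
    rw [sqrtOneSub, defect, ContinuousLinearMap.adjoint_adjoint, rowOp_comp_adjoint]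
  have hnorm := norm_rowOp_le hT
  rw [← hR]
  exact comp_sqrtOneSub hnorm x

theorem adjoint_rowOp_defect {T : Fin n → H →L[ℂ] H} (hT : IsRowContraction T) (h : H) :
    ((rowOp T)†) (defect T h) = defectAdj T (((rowOp T)†) h) := by
  refine ext_inner_right ℂ fun y => ?_
  rw [ContinuousLinearMap.adjoint_inner_left, inner_defect, ← rowOp_defectAdj hT, inner_defectAdj,
    ContinuousLinearMap.adjoint_inner_left]

theorem adjoint_rowOp_mem_defectAdjSpace {T : Fin n → H →L[ℂ] H} (hT : IsRowContraction T) {d : H}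
    (hd : d ∈ defectSpace T) : ((rowOp T)†) d ∈ defectAdjSpace T := by
  have hle : defectSpace T ≤ (defectAdjSpace T).comap ((rowOp T)†).toLinearMap := by
    refine Submodule.topologicalClosure_minimal _ ?_
      ((Submodule.isClosed_topologicalClosure _).preimage ((rowOp T)†).continuous)
    rintro _ ⟨y, rfl⟩
    change ((rowOp T)†) (defect T y) ∈ defectAdjSpace T
    rw [adjoint_rowOp_defect hT]
    exact defectAdj_mem T _
  exact hle hd

end Intertwining

/-! ### The characteristic function determines the Gram matrix of the vectors `T_β Δ_T d` -/

section Gram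

variable {n : ℕ} {H : Type u} [NormedAddCommGroup H] [InnerProductSpace ℂ H] [CompleteSpace H]

instance (T : Fin n → H →L[ℂ] H) : CompleteSpace (defectSpace T) :=
  Submodule.topologicalClosure.completeSpace _

instance (T : Fin n → H →L[ℂ] H) : CompleteSpace (defectAdjSpace T) :=
  Submodule.topologicalClosure.completeSpace _

/-- The vector `T_β Δ_T d`, for `d ∈ 𝒟_T`; it is the image of `e_β ⊗ d` under `K_T*`. -/
def gramVec (T : RowBall n H) (β : FreeMonoid (Fin n)) (d : defectSpace T.1) : H :=
  evalWord T.1 β (defect T.1 d)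

theorem gramVec_one (T : RowBall n H) (d : defectSpace T.1) :
    gramVec T 1 d = defect T.1 d := rfl

theorem gramVec_of_mul (T : RowBall n H) (i : Fin n) (β : FreeMonoid (Fin n))
    (d : defectSpace T.1) : gramVec T (FreeMonoid.of i * β) d = T.1 i (gramVec T β d) := by
  rw [gramVec, evalWord_mul_apply, evalWord_of]; rfl

theorem adjoint_revCoeff_one (T : RowBall n H) (d : defectSpace T.1) :
    (((revCoeff T 1)†) d : Copies n H) = -((rowOp T.1)†) d := by
  have : ((revCoeff T 1)†) d
      = -⟨((rowOp T.1)†) d, adjoint_rowOp_mem_defectAdjSpace T.2 d.2⟩ := by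
    refine ext_inner_left ℂ fun x => ?_
    rw [ContinuousLinearMap.adjoint_inner_right, Submodule.coe_inner, Submodule.coe_inner]
    change ⟪-rowOp T.1 x, (d : H)⟫_ℂ = ⟪(x : Copies n H), -((rowOp T.1)†) d⟫_ℂ
    rw [inner_neg_left, inner_neg_right, ContinuousLinearMap.adjoint_inner_right]
  rw [this]
  rfl

theorem adjoint_revCoeff_of_mul (T : RowBall n H) (j : Fin n) (β : FreeMonoid (Fin n))
    (d : defectSpace T.1) :
    (((revCoeff T (FreeMonoid.of j * β))†) d : Copies n H)
      = defectAdj T.1 (WithLp.toLp 2 (Pi.single j (gramVec T β d) : Fin n → H)) := by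
  have : ((revCoeff T (FreeMonoid.of j * β))†) d
      = ⟨_, defectAdj_mem T.1 (WithLp.toLp 2 (Pi.single j (gramVec T β d) : Fin n → H))⟩ := by
    refine ext_inner_left ℂ fun x => ?_
    rw [ContinuousLinearMap.adjoint_inner_right, Submodule.coe_inner, Submodule.coe_inner]
    change ⟪defect T.1 (((evalWord T.1 β)†) (defectAdj T.1 x j)), (d : H)⟫_ℂ = _
    rw [← inner_defectAdj, inner_single_right, inner_defect,
      ContinuousLinearMap.adjoint_inner_left]
    rfl
  rw [this]

/-- This and the next two lemmas are the entries of `I - K_T K_T* = Θ Θ*` on the Fock space, written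
as a recursion on the lengths of the words. -/
theorem inner_gramVec_one_one (T : RowBall n H) (d d' : defectSpace T.1) :
    ⟪gramVec T 1 d, gramVec T 1 d'⟫_ℂ
      = ⟪d, d'⟫_ℂ - ⟪((revCoeff T 1)†) d, ((revCoeff T 1)†) d'⟫_ℂ := by
  rw [Submodule.coe_inner, Submodule.coe_inner, adjoint_revCoeff_one, adjoint_revCoeff_one,
    inner_neg_neg, gramVec_one, gramVec_one, ← inner_defect, defect_defect T.2, inner_sub_left,
    ContinuousLinearMap.adjoint_inner_right, rowOp_apply]
  simp only [adjoint_rowOp_apply]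

theorem inner_gramVec_of_mul_one (T : RowBall n H) (i : Fin n) (β : FreeMonoid (Fin n))
    (d d' : defectSpace T.1) :
    ⟪gramVec T (FreeMonoid.of i * β) d, gramVec T 1 d'⟫_ℂ
      = -⟪((revCoeff T (FreeMonoid.of i * β))†) d, ((revCoeff T 1)†) d'⟫_ℂ := by
  rw [Submodule.coe_inner, adjoint_revCoeff_one, adjoint_revCoeff_of_mul, inner_neg_right, neg_neg,
    inner_defectAdj, ← adjoint_rowOp_defect T.2, ContinuousLinearMap.adjoint_inner_right,
    rowOp_single, gramVec_of_mul, gramVec_one]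

theorem inner_gramVec_of_mul_of_mul (T : RowBall n H) (i j : Fin n) (β α : FreeMonoid (Fin n))
    (d d' : defectSpace T.1) :
    ⟪gramVec T (FreeMonoid.of i * β) d, gramVec T (FreeMonoid.of j * α) d'⟫_ℂ
      = (if i = j then ⟪gramVec T β d, gramVec T α d'⟫_ℂ else 0)
        - ⟪((revCoeff T (FreeMonoid.of i * β))†) d,
          ((revCoeff T (FreeMonoid.of j * α))†) d'⟫_ℂ := by
  rw [Submodule.coe_inner, adjoint_revCoeff_of_mul, adjoint_revCoeff_of_mul, ← inner_defectAdj,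
    defectAdj_defectAdj T.2, inner_sub_left, ContinuousLinearMap.adjoint_inner_left, rowOp_single,
    rowOp_single, gramVec_of_mul, gramVec_of_mul, inner_single_right]
  by_cases hij : i = j
  · subst hij; simp
  · simp [hij, eq_comm]

variable {H' : Type v} [NormedAddCommGroup H'] [InnerProductSpace ℂ H'] [CompleteSpace H']

/-- If `τ₁` and `τ₂` intertwine the coefficients of two characteristic functions, then the vectors
`T_β Δ_T d` and `T'_β Δ_{T'} τ₂ d` have the same Gram matrix. -/
theorem inner_gramVec_eq {T : RowBall n H} {T' : RowBall n H'}
    (τ₁ : defectAdjSpace T.1 ≃ₗᵢ[ℂ] defectAdjSpace T'.1)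
    (τ₂ : defectSpace T.1 ≃ₗᵢ[ℂ] defectSpace T'.1)
    (h : ∀ α x, revCoeff T' α (τ₁ x) = τ₂ (revCoeff T α x)) (β α : FreeMonoid (Fin n))
    (d d' : defectSpace T.1) :
    ⟪gramVec T' β (τ₂ d), gramVec T' α (τ₂ d')⟫_ℂ = ⟪gramVec T β d, gramVec T α d'⟫_ℂ := by
  have hadj : ∀ α d, ((revCoeff T' α)†) (τ₂ d) = τ₁ (((revCoeff T α)†) d) := by
    intro α d
    refine ext_inner_left ℂ fun y => ?_
    obtain ⟨x, rfl⟩ := τ₁.surjective y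
    rw [ContinuousLinearMap.adjoint_inner_right, h, LinearIsometryEquiv.inner_map_map,
      LinearIsometryEquiv.inner_map_map, ContinuousLinearMap.adjoint_inner_right]
  have hB : ∀ γ δ d d', ⟪((revCoeff T' γ)†) (τ₂ d), ((revCoeff T' δ)†) (τ₂ d')⟫_ℂ
      = ⟪((revCoeff T γ)†) d, ((revCoeff T δ)†) d'⟫_ℂ := fun γ δ d d' => by
    rw [hadj, hadj, LinearIsometryEquiv.inner_map_map]
  induction β using FreeMonoid.inductionOn' generalizing α with
  | one =>
    induction α using FreeMonoid.inductionOn' with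
    | one =>
      rw [inner_gramVec_one_one, inner_gramVec_one_one, hB, LinearIsometryEquiv.inner_map_map]
    | of_mul j α _ =>
      rw [← inner_conj_symm, inner_gramVec_of_mul_one, hB, ← inner_gramVec_of_mul_one,
        inner_conj_symm]
  | of_mul i β ih =>
    induction α using FreeMonoid.inductionOn' with
    | one => rw [inner_gramVec_of_mul_one, inner_gramVec_of_mul_one, hB]
    | of_mul j α _ => rw [inner_gramVec_of_mul_of_mul, inner_gramVec_of_mul_of_mul, hB, ih]

theorem denseRange_linearCombination_gramVec {T : RowBall n H} (hc : IsCNC T.1) {ι : Type*}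
    {f : ι → H} (hf : ∀ β d, gramVec T β d ∈ Set.range f) :
    DenseRange (Finsupp.linearCombination ℂ f) := by
  have hr : Set.range (Finsupp.linearCombination ℂ f)
      = (Submodule.span ℂ (Set.range f) : Set H) := by
    rw [← Finsupp.range_linearCombination]; rfl
  rw [DenseRange, hr, Submodule.dense_iff_topologicalClosure_eq_top,
    Submodule.topologicalClosure_eq_top_iff, Submodule.eq_bot_iff]
  intro x hx
  refine hc x fun α => ?_
  have h0 : ∀ d : defectSpace T.1, ⟪(d : H), defect T.1 (((evalWord T.1 α)†) x)⟫_ℂ = 0 := by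
    intro d
    rw [← inner_defect, ContinuousLinearMap.adjoint_inner_right]
    exact (Submodule.mem_orthogonal _ _).mp hx _ (Submodule.subset_span (hf α d))
  exact inner_self_eq_zero.mp (h0 ⟨_, defect_mem T.1 _⟩)

/-- Coincidence of the coefficients gives unitary equivalence: the unitary maps `T_β Δ_T d` to
`T'_β Δ_{T'} τ₂ d`. -/
theorem unitarilyEquivalent_of_revCoeff {T : RowBall n H} {T' : RowBall n H'} (hc : IsCNC T.1)
    (hc' : IsCNC T'.1) (τ₁ : defectAdjSpace T.1 ≃ₗᵢ[ℂ] defectAdjSpace T'.1)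
    (τ₂ : defectSpace T.1 ≃ₗᵢ[ℂ] defectSpace T'.1)
    (h : ∀ α x, revCoeff T' α (τ₁ x) = τ₂ (revCoeff T α x)) : UnitarilyEquivalent T T' := by
  set f : FreeMonoid (Fin n) × defectSpace T.1 → H := fun p => gramVec T p.1 p.2 with hf
  set f' : FreeMonoid (Fin n) × defectSpace T.1 → H' := fun p => gramVec T' p.1 (τ₂ p.2) with hf'
  have hd : DenseRange (Finsupp.linearCombination ℂ f) :=
    denseRange_linearCombination_gramVec hc fun β d => ⟨(β, d), rfl⟩
  have hd' : DenseRange (Finsupp.linearCombination ℂ f') :=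
    denseRange_linearCombination_gramVec hc' fun β d =>
      ⟨(β, τ₂.symm d), by simp [hf']⟩
  have hnorm : ∀ c, ‖Finsupp.linearCombination ℂ f' (LinearEquiv.refl ℂ _ c)‖
      = ‖Finsupp.linearCombination ℂ f c‖ := by
    intro c
    rw [LinearEquiv.refl_apply, norm_eq_sqrt_re_inner (𝕜 := ℂ), norm_eq_sqrt_re_inner (𝕜 := ℂ)]
    simp only [Finsupp.linearCombination_apply, Finsupp.sum_inner, Finsupp.inner_sum, hf, hf',
      inner_smul_left, inner_smul_right, inner_gramVec_eq τ₁ τ₂ h]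
  set U := (LinearEquiv.refl ℂ _).extendOfIsometry (Finsupp.linearCombination ℂ f)
    (Finsupp.linearCombination ℂ f') hd hd' hnorm with hU
  have hUc : ∀ c, U (Finsupp.linearCombination ℂ f c) = Finsupp.linearCombination ℂ f' c :=
    fun c => LinearEquiv.extendOfIsometry_eq _ _ _ hd hd' hnorm c
  have hUf : ∀ β d, U (gramVec T β d) = gramVec T' β (τ₂ d) := by
    intro β d
    simpa using hUc (Finsupp.single (β, d) 1)
  refine ⟨U, fun i => ?_⟩
  refine fun x => hd.induction_on (p := fun x => U (T.1 i x) = T'.1 i (U x)) x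
    (isClosed_eq (by fun_prop) (by fun_prop)) fun c => ?_
  induction c using Finsupp.induction_linear with
  | zero => simp
  | add c c' hc hc' => simp only [map_add, hc, hc']
  | single p a =>
    obtain ⟨β, d⟩ := p
    simp only [Finsupp.linearCombination_single, map_smul, hf]
    rw [← gramVec_of_mul, hUf, hUf, gramVec_of_mul]

end Gram

/-! ### Transport along unitaries -/

section Transport

variable {E : Type u} {E' : Type v} {F : Type w} {F' : Type x}
  [NormedAddCommGroup E] [InnerProductSpace ℂ E] [NormedAddCommGroup E'] [InnerProductSpace ℂ E']
  [NormedAddCommGroup F] [InnerProductSpace ℂ F] [NormedAddCommGroup F'] [InnerProductSpace ℂ F']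

theorem adjoint_intertwine [CompleteSpace E] [CompleteSpace E'] [CompleteSpace F]
    [CompleteSpace F'] {W : E ≃ₗᵢ[ℂ] E'} {Z : F ≃ₗᵢ[ℂ] F'} {A : E →L[ℂ] F} {A' : E' →L[ℂ] F'}
    (h : ∀ x, Z (A x) = A' (W x)) (y : F) : W ((A†) y) = (A'†) (Z y) := by
  refine ext_inner_right ℂ fun z => ?_
  obtain ⟨x, rfl⟩ := W.surjective z
  rw [ContinuousLinearMap.adjoint_inner_left, ← h, LinearIsometryEquiv.inner_map_map,
    LinearIsometryEquiv.inner_map_map, ContinuousLinearMap.adjoint_inner_left]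

theorem sqrt_intertwine [CompleteSpace E] [CompleteSpace E'] {W : E ≃ₗᵢ[ℂ] E'}
    {p : E →L[ℂ] E} (hp : 0 ≤ p) {a : E' →L[ℂ] E'} (h : ∀ x, a (W x) = W (p (p x))) (x : E) :
    W (p x) = CFC.sqrt a (W x) := by
  set b : E' →L[ℂ] E' :=
    (W : E →L[ℂ] E') ∘L p ∘L ((W : E →L[ℂ] E')†) with hb
  have hbW : ∀ x, b (W x) = W (p x) := fun x => by simp [hb]
  have hb0 : 0 ≤ b := by
    rw [ContinuousLinearMap.nonneg_iff_isPositive] at hp ⊢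
    exact hp.conj_adjoint _
  have hbb : b * b = a := by
    ext y
    obtain ⟨x, rfl⟩ := W.surjective y
    rw [mul_apply_eq_comp, hbW, hbW, h]
  rw [CFC.sqrt_unique hbb hb0, hbW]

theorem sqrtOneSub_intertwine [CompleteSpace E] [CompleteSpace E'] [CompleteSpace F]
    [CompleteSpace F'] {W : E ≃ₗᵢ[ℂ] E'} {Z : F ≃ₗᵢ[ℂ] F'} {A : E →L[ℂ] F} {A' : E' →L[ℂ] F'}
    (hA : ‖A‖ ≤ 1) (h : ∀ x, Z (A x) = A' (W x)) (x : E) :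
    W (sqrtOneSub A x) = sqrtOneSub A' (W x) := by
  have h0 : 0 ≤ sqrtOneSub A := CFC.sqrt_nonneg _
  refine sqrt_intertwine h0 (fun y => ?_) x
  have hsq : sqrtOneSub A (sqrtOneSub A y) = y - (A†) (A y) :=
    congrArg (fun B : E →L[ℂ] E => B y) (sqrtOneSub_sq hA)
  rw [hsq, map_sub, adjoint_intertwine h, h]
  rfl

theorem mem_topologicalClosure_iff_of_equiv {W : E ≃ₗᵢ[ℂ] E'} {S : Submodule ℂ E}
    {S' : Submodule ℂ E'} (h : ∀ x, x ∈ S ↔ W x ∈ S') (x : E) :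
    x ∈ S.topologicalClosure ↔ W x ∈ S'.topologicalClosure := by
  have h1 : (S : Set E) = W.toHomeomorph ⁻¹' (S' : Set E') := Set.ext h
  rw [← SetLike.mem_coe, ← SetLike.mem_coe, Submodule.topologicalClosure_coe,
    Submodule.topologicalClosure_coe, h1, ← Homeomorph.preimage_closure]
  rfl

theorem mem_range_iff_of_equiv {W : E ≃ₗᵢ[ℂ] E'} {A : E →L[ℂ] E} {A' : E' →L[ℂ] E'}
    (h : ∀ x, W (A x) = A' (W x)) (x : E) :
    x ∈ LinearMap.range A.toLinearMap ↔ W x ∈ LinearMap.range A'.toLinearMap := by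
  constructor
  · rintro ⟨y, rfl⟩
    exact ⟨W y, (h y).symm⟩
  · rintro ⟨y, hy⟩
    obtain ⟨z, rfl⟩ := W.surjective y
    exact ⟨z, W.injective ((h z).trans hy)⟩

/-- The restriction of a unitary to corresponding subspaces. -/
def restrictEquiv (W : E ≃ₗᵢ[ℂ] E') {S : Submodule ℂ E} {S' : Submodule ℂ E'}
    (h : ∀ x, x ∈ S ↔ W x ∈ S') : S ≃ₗᵢ[ℂ] S' where
  toFun x := ⟨W x, (h x).mp x.2⟩
  map_add' x y := Subtype.ext (map_add W _ _)
  map_smul' c x := Subtype.ext (map_smul W c _)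
  invFun y := ⟨W.symm y, (h _).mpr (by rw [W.apply_symm_apply]; exact y.2)⟩
  left_inv x := Subtype.ext (W.symm_apply_apply _)
  right_inv y := Subtype.ext (W.apply_symm_apply _)
  norm_map' x := W.norm_map _

theorem dimension_eq_of_equiv (W : E ≃ₗᵢ[ℂ] E') {S : Submodule ℂ E} {S' : Submodule ℂ E'}
    (h : ∀ x, x ∈ S ↔ W x ∈ S') : dimension S = dimension S' := by
  have h1 := (restrictEquiv W h).toLinearEquiv.lift_rank_eq
  have h2 := congrArg Cardinal.toENat h1
  rwa [Cardinal.toENat_lift, Cardinal.toENat_lift] at h2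

end Transport

/-! ### Invariance under unitary equivalence -/

section Unitary

variable {n : ℕ} {H : Type u} [NormedAddCommGroup H] [InnerProductSpace ℂ H] [CompleteSpace H]
  {H' : Type v} [NormedAddCommGroup H'] [InnerProductSpace ℂ H'] [CompleteSpace H']
  {T : Fin n → H →L[ℂ] H} {T' : Fin n → H' →L[ℂ] H'} {U : H ≃ₗᵢ[ℂ] H'}

/-- The unitary `U ⊕ ⋯ ⊕ U : H⁽ⁿ⁾ → H'⁽ⁿ⁾`. -/
def copiesEquiv (n : ℕ) (U : H ≃ₗᵢ[ℂ] H') : Copies n H ≃ₗᵢ[ℂ] Copies n H' :=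
  LinearIsometryEquiv.piLpCongrRight 2 fun _ => U

omit [CompleteSpace H] [CompleteSpace H'] in
theorem copiesEquiv_apply (U : H ≃ₗᵢ[ℂ] H') (x : Copies n H) (i : Fin n) :
    copiesEquiv n U x i = U (x i) := rfl

omit [CompleteSpace H] [CompleteSpace H'] in
theorem map_evalWord (hU : ∀ i h, U (T i h) = T' i (U h)) (α : FreeMonoid (Fin n)) (h : H) :
    U (evalWord T α h) = evalWord T' α (U h) := by
  induction α using FreeMonoid.inductionOn' with
  | one => rfl
  | of_mul i α ih =>
    rw [evalWord_mul_apply, evalWord_mul_apply, evalWord_of, evalWord_of, hU, ih]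

theorem map_rowOp (hU : ∀ i h, U (T i h) = T' i (U h)) (x : Copies n H) :
    U (rowOp T x) = rowOp T' (copiesEquiv n U x) := by
  rw [rowOp_apply, rowOp_apply, map_sum]
  exact Finset.sum_congr rfl fun i _ => hU i _

theorem map_defect (hT : IsRowContraction T) (hU : ∀ i h, U (T i h) = T' i (U h)) (h : H) :
    U (defect T h) = defect T' (U h) := by
  have h0 : 0 ≤ defect T := CFC.sqrt_nonneg _
  refine sqrt_intertwine h0 (fun x => ?_) h
  have h1 : ∀ i y, U (((T i)†) y) = ((T' i)†) (U y) := fun i => adjoint_intertwine (hU i)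
  rw [defect_defect hT, map_sub, map_sum, sub_apply, one_apply_eq_self, sum_apply]
  simp only [hU, h1, ContinuousLinearMap.comp_apply]

theorem map_defectAdj (hT : IsRowContraction T) (hU : ∀ i h, U (T i h) = T' i (U h))
    (x : Copies n H) :
    copiesEquiv n U (defectAdj T x) = defectAdj T' (copiesEquiv n U x) := by
  have hnorm := norm_rowOp_le hT
  exact sqrtOneSub_intertwine hnorm (map_rowOp hU) x

theorem mem_defectSpace_iff (hT : IsRowContraction T) (hU : ∀ i h, U (T i h) = T' i (U h))
    (x : H) : x ∈ defectSpace T ↔ U x ∈ defectSpace T' :=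
  mem_topologicalClosure_iff_of_equiv (mem_range_iff_of_equiv (map_defect hT hU)) x

theorem mem_defectAdjSpace_iff (hT : IsRowContraction T) (hU : ∀ i h, U (T i h) = T' i (U h))
    (x : Copies n H) : x ∈ defectAdjSpace T ↔ copiesEquiv n U x ∈ defectAdjSpace T' :=
  mem_topologicalClosure_iff_of_equiv (mem_range_iff_of_equiv (map_defectAdj hT hU)) x

theorem mem_spanSpace_iff (hT : IsRowContraction T) (hU : ∀ i h, U (T i h) = T' i (U h))
    (m : ℕ) (x : H) : x ∈ spanSpace T m ↔ U x ∈ spanSpace T' m := by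
  refine mem_topologicalClosure_iff_of_equiv (fun x => ?_) x
  have h1 : {x | ∃ (β : FreeMonoid (Fin n)) (h : H'),
        m ≤ β.length ∧ x = evalWord T' β (defect T' h)}
      = U '' {x | ∃ (β : FreeMonoid (Fin n)) (h : H),
        m ≤ β.length ∧ x = evalWord T β (defect T h)} := by
    ext y
    constructor
    · rintro ⟨β, h, hβ, rfl⟩
      obtain ⟨h, rfl⟩ := U.surjective h
      exact ⟨_, ⟨β, h, hβ, rfl⟩, by rw [map_evalWord hU, map_defect hT hU]⟩
    · rintro ⟨_, ⟨β, h, hβ, rfl⟩, rfl⟩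
      exact ⟨β, U h, hβ, by rw [map_evalWord hU, map_defect hT hU]⟩
  have h2 : Submodule.span ℂ (U '' {x | ∃ (β : FreeMonoid (Fin n)) (h : H),
        m ≤ β.length ∧ x = evalWord T β (defect T h)})
      = (Submodule.span ℂ {x | ∃ (β : FreeMonoid (Fin n)) (h : H),
        m ≤ β.length ∧ x = evalWord T β (defect T h)}).map U.toLinearEquiv.toLinearMap :=
    Submodule.span_image U.toLinearEquiv.toLinearMap
  rw [h1, h2]
  constructor
  · exact fun hx => ⟨x, hx, rfl⟩
  · rintro ⟨y, hy, hyx⟩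
    rwa [← U.injective hyx]

theorem exists_revCoeff_intertwine {T : RowBall n H} {T' : RowBall n H'}
    (h : UnitarilyEquivalent T T') :
    ∃ (τ₁ : defectAdjSpace T.1 ≃ₗᵢ[ℂ] defectAdjSpace T'.1)
      (τ₂ : defectSpace T.1 ≃ₗᵢ[ℂ] defectSpace T'.1),
      ∀ α x, revCoeff T' α (τ₁ x) = τ₂ (revCoeff T α x) := by
  obtain ⟨U, hU⟩ := h
  refine ⟨restrictEquiv _ (mem_defectAdjSpace_iff T.2 hU),
    restrictEquiv U (mem_defectSpace_iff T.2 hU), fun α x => Subtype.ext ?_⟩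
  cases α using FreeMonoid.casesOn with
  | one =>
    change -rowOp T'.1 (copiesEquiv n U x) = U (-rowOp T.1 x)
    rw [map_neg, map_rowOp hU]
  | of_mul j α =>
    change defect T'.1 (((evalWord T'.1 α)†) (defectAdj T'.1 (copiesEquiv n U x) j))
      = U (defect T.1 (((evalWord T.1 α)†) (defectAdj T.1 x j)))
    rw [map_defect T.2 hU, adjoint_intertwine (map_evalWord hU α), ← map_defectAdj T.2 hU,
      copiesEquiv_apply]

theorem UnitarilyEquivalent.symm {T : RowBall n H} {T' : RowBall n H'}
    (h : UnitarilyEquivalent T T') : UnitarilyEquivalent T' T := by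
  obtain ⟨U, hU⟩ := h
  refine ⟨U.symm, fun i y => U.injective ?_⟩
  rw [hU, U.apply_symm_apply, U.apply_symm_apply]

theorem UnitarilyEquivalent.hasCharDegreeLE {T : RowBall n H} {T' : RowBall n H'}
    (h : UnitarilyEquivalent T T') {m : ℕ} (hm : HasCharDegreeLE T m) : HasCharDegreeLE T' m := by
  obtain ⟨τ₁, τ₂, hτ⟩ := exists_revCoeff_intertwine h
  rw [hasCharDegreeLE_iff] at hm ⊢
  intro α hα
  ext1 y
  obtain ⟨x, rfl⟩ := τ₁.surjective y
  have h0 : revCoeff T α.reverse = 0 := hm α hα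
  rw [charCoeff, hτ, h0]
  simp

theorem UnitarilyEquivalent.charDegree_eq {T : RowBall n H} {T' : RowBall n H'}
    (h : UnitarilyEquivalent T T') : charDegree T = charDegree T' :=
  iInf_congr fun _ => iInf_congr_Prop ⟨h.hasCharDegreeLE, h.symm.hasCharDegreeLE⟩ fun _ => rfl

theorem UnitarilyEquivalent.gammaFst_eq {T : RowBall n H} {T' : RowBall n H'}
    (h : UnitarilyEquivalent T T') : gammaFst T = gammaFst T' := by
  obtain ⟨U, hU⟩ := id h
  rw [gammaFst, gammaFst, h.charDegree_eq]
  split_ifs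
  · exact dimension_eq_of_equiv U (mem_defectSpace_iff T.2 hU)
  · refine dimension_eq_of_equiv U fun x => ?_
    rw [Submodule.mem_inf, Submodule.mem_inf, mem_spanSpace_iff T.2 hU, Submodule.mem_orthogonal,
      Submodule.mem_orthogonal]
    refine and_congr_right' ⟨fun hx y hy => ?_, fun hx y hy => ?_⟩
    · obtain ⟨z, rfl⟩ := U.surjective y
      rw [U.inner_map_map]
      exact hx z ((mem_spanSpace_iff T.2 hU _ z).mpr hy)
    · rw [← U.inner_map_map]
      exact hx _ ((mem_spanSpace_iff T.2 hU _ y).mp hy)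

theorem charFunCoincide_of_unitarilyEquivalent {T : RowBall n H} {T' : RowBall n H'}
    (hp : HasPolynomialCharFun T) (h : UnitarilyEquivalent T T') (G : Type w)
    [NormedAddCommGroup G] [InnerProductSpace ℂ G] [CompleteSpace G] : CharFunCoincide G T T' := by
  obtain ⟨m, hm⟩ := hp
  have hm' := h.hasCharDegreeLE hm
  rw [hasCharDegreeLE_iff] at hm hm'
  obtain ⟨τ₁, τ₂, hτ⟩ := exists_revCoeff_intertwine h
  have hc : ∀ α, charCoeff T' α ∘L (τ₁ : defectAdjSpace T.1 →L[ℂ] defectAdjSpace T'.1)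
      = (τ₂ : defectSpace T.1 →L[ℂ] defectSpace T'.1) ∘L charCoeff T α := fun α =>
    ContinuousLinearMap.ext fun x => hτ α.reverse x
  exact ⟨τ₁, τ₂, fun X hX => charFun_comp_of_charCoeff_comp hm hm' hc hX⟩

theorem CharFunCoincide.unitarilyEquivalent {T : RowBall n H} {T' : RowBall n H'} {G : Type w}
    [NormedAddCommGroup G] [InnerProductSpace ℂ G] [CompleteSpace G]
    (hG : ¬ FiniteDimensional ℂ G) (h : CharFunCoincide G T T') (hc : IsCNC T.1)
    (hc' : IsCNC T'.1) : UnitarilyEquivalent T T' := by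
  obtain ⟨τ₁, τ₂, hτ⟩ := h
  refine unitarilyEquivalent_of_revCoeff hc hc' τ₁ τ₂ fun α x => ?_
  have h1 := charCoeff_comp_of_charFun_comp hG hτ α.reverse
  rw [charCoeff, charCoeff, FreeMonoid.reverse_reverse] at h1
  exact congrArg (fun B : defectAdjSpace T.1 →L[ℂ] defectSpace T'.1 => B x) h1

theorem UnitarilyEquivalent.gamma_eq {T : RowBall n H} {T' : RowBall n H'}
    (h : UnitarilyEquivalent T T') (hc : IsCNC T.1) (hc' : IsCNC T'.1) : Gamma T = Gamma T' := by
  have h1 := (dimension_eq_zero_iff _).mpr ((ker_poissonKernel_eq_bot_iff T).mpr hc)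
  have h2 := (dimension_eq_zero_iff _).mpr ((ker_poissonKernel_eq_bot_iff T').mpr hc')
  rw [Gamma, Gamma, h1, h2, h.gammaFst_eq, h.charDegree_eq]

end Unitary

end RowContr

end

/-! ### Detection and classification -/

theorem theorem2p4 {n : ℕ} (hn : 0 < n)
    {H : Type*} [NormedAddCommGroup H] [InnerProductSpace ℂ H] [CompleteSpace H]
    (T : RowContr.RowBall n H) :
    ((RowContr.IsPure T.1 ∧ RowContr.HasPolynomialCharFun T) ↔
      RowContr.Gamma T ∈ RowContr.pureGamma) ∧
    (RowContr.Gamma T ∈ RowContr.pureGamma → RowContr.HasCanonicalVNForm T) ∧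
    (∀ {H' : Type*} [NormedAddCommGroup H'] [InnerProductSpace ℂ H'] [CompleteSpace H']
      (T' : RowContr.RowBall n H')
      {G : Type*} [NormedAddCommGroup G] [InnerProductSpace ℂ G] [CompleteSpace G]
      (_ : ¬ FiniteDimensional ℂ G),
      (((RowContr.IsPure T.1 ∧ RowContr.HasPolynomialCharFun T) ∧
          (RowContr.IsPure T'.1 ∧ RowContr.HasPolynomialCharFun T') ∧
          RowContr.UnitarilyEquivalent T T') ↔
        (RowContr.Gamma T ∈ RowContr.pureGamma ∧ RowContr.Gamma T' ∈ RowContr.pureGamma ∧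
          RowContr.CharFunCoincide G T T')) ∧
      (RowContr.IsPure T.1 → RowContr.HasPolynomialCharFun T →
        RowContr.IsPure T'.1 → RowContr.HasPolynomialCharFun T' →
        (RowContr.UnitarilyEquivalent T T' ↔
          (RowContr.Gamma T = RowContr.Gamma T' ∧ RowContr.CharFunCoincide G T T')))) := by
  refine ⟨RowContr.isPure_and_hasPolynomialCharFun_iff T, fun h => ?_, ?_⟩
  · have h1 := (RowContr.gamma_mem_pureGamma_iff T).mp h
    exact RowContr.hasCanonicalVNForm h1.1 h1.2
  · intro H' _ _ _ T' G _ _ _ hG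
    refine ⟨?_, fun hT hpT hT' hpT' => ?_⟩
    · rw [RowContr.isPure_and_hasPolynomialCharFun_iff T,
        RowContr.isPure_and_hasPolynomialCharFun_iff T']
      refine and_congr_right fun h => and_congr_right fun h' => ?_
      have hp := (RowContr.isPure_and_hasPolynomialCharFun_iff T).mpr h
      exact ⟨fun hU => RowContr.charFunCoincide_of_unitarilyEquivalent hp.2 hU G,
        fun hC => hC.unitarilyEquivalent hG ((RowContr.gamma_mem_pureGamma_iff T).mp h).2
          ((RowContr.gamma_mem_pureGamma_iff T').mp h').2⟩
    · have hc := hT.isCNC T.2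
      have hc' := hT'.isCNC T'.2
      exact ⟨fun hU => ⟨hU.gamma_eq hc hc',
          RowContr.charFunCoincide_of_unitarilyEquivalent hpT hU G⟩,
        fun h => h.2.unitarilyEquivalent hG hc hc'⟩
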